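/- **Algorithms.** Algorithms are programs for a machine with finitely many bit stacks that can push, pop, branch, loop, flip coins, query a sample oracle (each query returns an independent sample), and, in the quantum case, apply $H$, $T$, $\mathrm{CNOT}$ gates to, measure, and reset a quantum memory. Running time is the number of elementary steps. A *classical* algorithm uses no quantum instruction; a *quantum* algorithm may use all of them. **LPN assumption.** For $s\in\{0,1\}^k$ and $\eta\in(0,1/2)$, a noisy parity sample is $(x,\,s\cdot x\oplus e)$ with $x\in\{0,1\}^k$ uniformly random and $e\in\{0,1\}$ independent with $\Pr[e=1]=\eta$. The learning parities with noise (LPN) assumption against classical (quantum) algorithms says: for no constant $\eta\in(0,1/2)$ is there a classical (quantum) algorithm that, for all $k$, all $s\in\{0,1\}^k$ and all $\delta\in(0,1)$, given $k$, $1/\delta$ and access to noisy parity samples of $s$, outputs $s$ with probability at least $1-\delta$ in time $\mathrm{poly}(k,1/\delta)$. **Learning with respect to an evaluator.** For each $n$ let $\mathcal D(n)$ be a set of probability distributions on $\{0,1\}^n$. An evaluator for a distribution $Q$ on $\{0,1\}^n$ is an algorithm without oracle access that on input $x\in\{0,1\}^n$ and $m\in\mathbb N$ (in unary) outputs $Q(x)$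 in binary up to an error of at most $2^{-m}$; randomized or quantum evaluators may fail with probability at most $2^{-m}$. The family $\mathcal D$ is *efficiently learnable with respect to an evaluator* by classical (quantum) algorithms if there is a classical (quantum) algorithm which, for all $n$, all $P\in\mathcal D(n)$ and all $\varepsilon,\delta\in(0,1)$, given $n,1/\varepsilon,1/\delta$ and access to independent samples from $P$, outputs in time $\mathrm{poly}(n,1/\varepsilon,1/\delta)$, with probability at least $1-\delta$, an evaluator, running in time $\mathrm{poly}(n,1/\varepsilon,1/\delta,m)$, for some probability distribution $Q$ with $\mathrm{TV}(P,Q)=\frac12\sum_x|P(x)-Q(x)|<\varepsilon$. (Evaluators are output as strings $w$ that are executed by an arbitrary fixed interpreter $E$ of the same kind: the evaluator is $E(w,\cdot)$.) **Circuit distributions.** Let $\mathcal D_{\mathrm{Cl}+T}(n,d)$ be the set of distributions $P(x)=|\langle x|U|0^n\rangle|^2$ on $\{0,1\}^n$, where $U$ is an $n$-qubit circuit of $d$ layers, each consisting of gates on pairwise disjoint wires, composed of $H$, $S=\mathrm{diag}(1,i)$ and nearest-neighbour (on a line) $\mathrm{CNOT}$ gates and exactly one gate $T=\mathrm{diag}(1,e^{i\pi/4})$.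 **Theorem.** Let $d:\mathbb N\to\mathbb N$ satisfy $d(n)=n^{\Omega(1)}$, i.e. there is $c>0$ with $d(n)\ge n^{c}$ for all sufficiently large $n$. If the LPN assumption holds against classical (respectively quantum) algorithms, then the family $\mathcal D_{\mathrm{Cl}+T}(n,d(n))$ is not efficiently learnable with respect to an evaluator by classical (respectively quantum) algorithms. -/

import Mathlib

noncomputable section

namespace QLearn

/-! ### Random bits -/

/-- A random bit that equals `true` with probability `p` (clamped to `[0, 1]`). -/
def biasedBit (p : ℝ) : PMF Bool :=
  PMF.ofFintype
    (fun b => if b then ENNReal.ofReal (max 0 (min 1 p)) else ENNReal.ofReal (1 - max 0 (min 1 p)))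
    (by
      have h0 : 0 ≤ max 0 (min 1 p) := le_max_left _ _
      have h1 : max 0 (min 1 p) ≤ 1 := max_le zero_le_one (min_le_left _ _)
      rw [Fintype.sum_bool]
      simp only [if_true, Bool.false_eq_true, if_false]
      rw [← ENNReal.ofReal_add h0 (by linarith)]
      simp)

/-! ### Machine model

A machine has registers indexed by `ℕ`, each holding a stack of bits (head of the list = top of the
stack), and a quantum memory with qubits indexed by `ℕ`.  A program is executed by small steps, and
running time is the number of small steps. -/

/-- A pure state of the quantum memory: the basis state `S` is the one in which exactly the qubits
in the finite set `S` are `1`.  States are kept unnormalized. -/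
abbrev QState : Type := Finset ℕ →₀ ℂ

/-- All qubits in state zero. -/
def QState.zero : QState := Finsupp.single ∅ 1

/-- Hadamard gate on qubit `q`. -/
def QState.had (q : ℕ) (ψ : QState) : QState :=
  ψ.sum fun S a =>
    Finsupp.single (S.erase q) (a / (Real.sqrt 2 : ℂ)) +
      Finsupp.single (insert q S) ((if q ∈ S then -a else a) / (Real.sqrt 2 : ℂ))

/-- `T = diag(1, exp(iπ/4))` on qubit `q`. -/
def QState.tgate (q : ℕ) (ψ : QState) : QState :=
  ψ.sum fun S a =>
    Finsupp.single S (if q ∈ S then Complex.exp (Complex.I * (Real.pi / 4 : ℝ)) * a else a)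

/-- CNOT with control `c` and target `t` (no operation if `c = t`). -/
def QState.cnot (c t : ℕ) (ψ : QState) : QState :=
  if c = t then ψ else ψ.mapDomain fun S => if c ∈ S then symmDiff S {t} else S

/-- The component of `ψ` in which qubit `q` has the value `b`. -/
def QState.proj (q : ℕ) (b : Bool) (ψ : QState) : QState :=
  ψ.filter fun S => decide (q ∈ S) = b

/-- Squared norm. -/
def QState.normSq (ψ : QState) : ℝ := ψ.sum fun _ a => ‖a‖ ^ 2

/-- Born probability of the outcome `1` when qubit `q` is measured. -/
def QState.probOne (q : ℕ) (ψ : QState) : ℝ := (ψ.proj q true).normSq / ψ.normSq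

/-- Programs.  In the quantum instructions a qubit is addressed by the length of the content of a
register. -/
inductive Prog : Type
  /-- push the bit `b` onto register `r` -/
  | push (r : ℕ) (b : Bool) : Prog
  /-- remove the top bit of register `r` (if any) -/
  | pop (r : ℕ) : Prog
  /-- empty register `r` -/
  | clear (r : ℕ) : Prog
  /-- sequential composition -/
  | seq (p q : Prog) : Prog
  /-- branch on the top bit of register `r`: execute `e`, `p` or `q` if register `r` is empty, has
  top bit `true`, or has top bit `false` -/
  | cond (r : ℕ) (e p q : Prog) : Prog
  /-- execute `p` as long as register `r` is nonempty -/
  | loop (r : ℕ) (p : Prog) : Prog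
  /-- push a fair coin flip onto register `r` -/
  | coin (r : ℕ) : Prog
  /-- query the sample oracle and store the answer in register `r` -/
  | sample (r : ℕ) : Prog
  /-- reset the quantum memory to the all-zero state -/
  | qreset : Prog
  /-- Hadamard gate on the qubit addressed by register `r` -/
  | had (r : ℕ) : Prog
  /-- T-gate on the qubit addressed by register `r` -/
  | tgate (r : ℕ) : Prog
  /-- CNOT with control addressed by `r` and target addressed by `r'` -/
  | cnot (r r' : ℕ) : Prog
  /-- measure the qubit addressed by `r` in the computational basis and push the outcome onto
  register `r'` -/
  | meas (r r' : ℕ) : Prog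

/-- The program uses no quantum instruction (it is an ordinary randomized program). -/
def Prog.IsClassical : Prog → Prop
  | .seq p q => p.IsClassical ∧ q.IsClassical
  | .cond _ e p q => e.IsClassical ∧ p.IsClassical ∧ q.IsClassical
  | .loop _ p => p.IsClassical
  | .qreset => False
  | .had _ => False
  | .tgate _ => False
  | .cnot _ _ => False
  | .meas _ _ => False
  | _ => True

/-- The program never queries the sample oracle. -/
def Prog.SampleFree : Prog → Prop
  | .seq p q => p.SampleFree ∧ q.SampleFree
  | .cond _ e p q => e.SampleFree ∧ p.SampleFree ∧ q.SampleFree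
  | .loop _ p => p.SampleFree
  | .sample _ => False
  | _ => True

/-- Content of the memory. -/
structure Mem : Type where
  /-- classical registers -/
  reg : ℕ → List Bool
  /-- quantum memory -/
  qmem : QState

/-- Overwrite register `r`. -/
def Mem.set (m : Mem) (r : ℕ) (l : List Bool) : Mem :=
  { m with reg := Function.update m.reg r l }

/-- A configuration: the stack of programs still to be executed, and the memory.  The machine has
halted when this stack is empty. -/
abbrev Config : Type := List Prog × Mem

/-- One computational step; every query to the sample oracle returns an independent sample from
`O`. -/
def step (O : PMF (List Bool)) : Config → PMF Config
  | ([], m) => PMF.pure ([], m)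
  | (.push r b :: k, m) => PMF.pure (k, m.set r (b :: m.reg r))
  | (.pop r :: k, m) => PMF.pure (k, m.set r (m.reg r).tail)
  | (.clear r :: k, m) => PMF.pure (k, m.set r [])
  | (.seq p q :: k, m) => PMF.pure (p :: q :: k, m)
  | (.cond r e p q :: k, m) =>
      match m.reg r with
      | [] => PMF.pure (e :: k, m)
      | true :: _ => PMF.pure (p :: k, m)
      | false :: _ => PMF.pure (q :: k, m)
  | (.loop r p :: k, m) =>
      match m.reg r with
      | [] => PMF.pure (k, m)
      | _ :: _ => PMF.pure (p :: .loop r p :: k, m)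
  | (.coin r :: k, m) => (biasedBit (1 / 2)).map fun b => (k, m.set r (b :: m.reg r))
  | (.sample r :: k, m) => O.map fun l => (k, m.set r l)
  | (.qreset :: k, m) => PMF.pure (k, { m with qmem := QState.zero })
  | (.had r :: k, m) => PMF.pure (k, { m with qmem := m.qmem.had (m.reg r).length })
  | (.tgate r :: k, m) => PMF.pure (k, { m with qmem := m.qmem.tgate (m.reg r).length })
  | (.cnot r r' :: k, m) =>
      PMF.pure (k, { m with qmem := m.qmem.cnot (m.reg r).length (m.reg r').length })
  | (.meas r r' :: k, m) =>
      (biasedBit (m.qmem.probOne (m.reg r).length)).map fun b =>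
        (k, { reg := Function.update m.reg r' (b :: m.reg r')
              qmem := m.qmem.proj (m.reg r).length b })

/-- The distribution of the configuration after `t` steps. -/
def runFor (O : PMF (List Bool)) : ℕ → Config → PMF Config
  | 0, c => PMF.pure c
  | t + 1, c => (step O c).bind (runFor O t)

/-- Initial memory: the inputs are in the registers `0, 1, 2, …`, all other registers are empty and
all qubits are zero. -/
def initMem (inputs : List (List Bool)) : Mem where
  reg := fun i => inputs.getD i []
  qmem := QState.zero

/-- The probability that `A`, run on the given inputs with sample access to `O`, halts within `t`
steps with an output (the content of register `0`) that satisfies `good`. -/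
def successProb (O : PMF (List Bool)) (A : Prog) (inputs : List (List Bool)) (t : ℕ)
    (good : List Bool → Prop) : ENNReal :=
  (runFor O t ([A], initMem inputs)).toOuterMeasure {c | c.1 = [] ∧ good (c.2.reg 0)}

/-- The two kinds of algorithms. -/
inductive Model : Type
  | classical
  | quantum

/-- Classical algorithms are (randomized) programs without quantum instructions; quantum algorithms
are arbitrary programs. -/
def Model.Allows : Model → Prog → Prop
  | .classical, A => A.IsClassical
  | .quantum, _ => True

/-- The number `m` in unary. -/
def unary (m : ℕ) : List Bool := List.replicate m true

/-! ### Learning parities with noise -/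

/-- The parity function `x ↦ s · x` modulo 2. -/
def parity {k : ℕ} (s x : Fin k → Bool) : Bool :=
  decide (Odd (Finset.univ.filter fun i => s i = true ∧ x i = true).card)

/-- A noisy sample of the parity function `s`: the `k` bits of a uniformly random `x`, followed by
the parity `s · x`, which is flipped independently with probability `η`. -/
def noisyParity {k : ℕ} (s : Fin k → Bool) (η : ℝ) : PMF (List Bool) :=
  (PMF.uniformOfFintype (Fin k → Bool)).bind fun x =>
    (biasedBit η).map fun e => List.ofFn x ++ [xor (parity s x) e]

/-- There is an efficient algorithm that learns parities with noise rate `η`: from noisy samples it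
finds the unknown parity function, with probability at least `1 - δ`, in time polynomial in the
number of bits and in `1/δ`. -/
def LPNEasy (M : Model) (η : ℝ) : Prop :=
  ∃ A : Prog, M.Allows A ∧ ∃ p : Polynomial ℕ,
    ∀ (k : ℕ) (s : Fin k → Bool) (δ : ℝ), 0 < δ → δ < 1 →
      ENNReal.ofReal (1 - δ) ≤
        successProb (noisyParity s η) A [unary k, unary ⌈1 / δ⌉₊] (p.eval (k + ⌈1 / δ⌉₊))
          (fun out => out = List.ofFn s)

/-- The LPN assumption against algorithms of kind `M`: for no constant noise rate is there an
efficient algorithm. -/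
def LPNAssumption (M : Model) : Prop :=
  ∀ η : ℝ, 0 < η → η < 1 / 2 → ¬ LPNEasy M η

/-! ### Learning distributions with respect to an evaluator -/

/-- Total variation distance. -/
def tv {n : ℕ} (P Q : PMF (Fin n → Bool)) : ℝ :=
  (1 / 2) * ∑ x, |(P x).toReal - (Q x).toReal|

/-- The sample oracle of `P`. -/
def samp {n : ℕ} (P : PMF (Fin n → Bool)) : PMF (List Bool) := P.map List.ofFn

/-- The number `0.b₁b₂…` in binary. -/
def binaryFrac : List Bool → ℝ
  | [] => 0
  | b :: l => ((if b then 1 else 0) + binaryFrac l) / 2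

/-- The algorithm `E(w, ·)`, that is, `E` with the string `w` hard-wired into it, is an evaluator
for `Q`: given `x` and a precision `m` in unary, it outputs, within `T m` steps, the binary
expansion of `Q(x)` up to an error of `2⁻ᵐ`.  (A failure probability of `2⁻ᵐ` is tolerated, which is
void for deterministic evaluators.) -/
def IsEvaluator {n : ℕ} (E : Prog) (w : List Bool) (T : ℕ → ℕ) (Q : PMF (Fin n → Bool)) : Prop :=
  ∀ (x : Fin n → Bool) (m : ℕ),
    ENNReal.ofReal (1 - (1 / 2 : ℝ) ^ m) ≤
      successProb (PMF.pure []) E [w, List.ofFn x, unary m] (T m)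
        (fun out => |binaryFrac out - (Q x).toReal| ≤ (1 / 2 : ℝ) ^ m)

/-- The classes `𝒟 n` of distributions on `n` bits are efficiently learnable from samples with
respect to an evaluator: there is a learning algorithm `A` which, given `n`, `1/ε`, `1/δ` and samples
from an unknown `P ∈ 𝒟 n`, outputs with probability at least `1 - δ`, in time
`poly(n, 1/ε, 1/δ)`, the description `w` of an efficient evaluator for some distribution `Q` with
`TV(P, Q) < ε`.  Descriptions `w` are interpreted by a fixed algorithm `E` which runs in polynomial
time and has no access to the samples; the language of descriptions is thus arbitrary. -/
def EfficientlyLearnable (M : Model) (𝒟 : (n : ℕ) → Set (PMF (Fin n → Bool))) : Prop :=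
  ∃ A E : Prog, M.Allows A ∧ M.Allows E ∧ E.SampleFree ∧ ∃ p : Polynomial ℕ,
    ∀ (n : ℕ), ∀ P ∈ 𝒟 n, ∀ (ε δ : ℝ), 0 < ε → ε < 1 → 0 < δ → δ < 1 →
      ENNReal.ofReal (1 - δ) ≤
        successProb (samp P) A [unary n, unary ⌈1 / ε⌉₊, unary ⌈1 / δ⌉₊]
          (p.eval (n + ⌈1 / ε⌉₊ + ⌈1 / δ⌉₊))
          (fun w => ∃ Q : PMF (Fin n → Bool), tv P Q < ε ∧
            IsEvaluator E w (fun m => p.eval (n + ⌈1 / ε⌉₊ + ⌈1 / δ⌉₊ + m)) Q)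

/-! ### Local Clifford circuits with one T-gate -/

/-- Clifford gates (from the standard generators of the Clifford group) and the T-gate, acting on
`n` qubits. -/
inductive Gate (n : ℕ) : Type
  | H (i : Fin n)
  | S (i : Fin n)
  | T (i : Fin n)
  | CNOT (c t : Fin n)

/-- The wires that a gate acts on. -/
def Gate.wires {n : ℕ} : Gate n → Finset (Fin n)
  | .H i => {i}
  | .S i => {i}
  | .T i => {i}
  | .CNOT c t => {c, t}

/-- Two-qubit gates act on nearest neighbours on a line. -/
def Gate.IsLocal {n : ℕ} : Gate n → Prop
  | .CNOT c t => c.val + 1 = t.val ∨ t.val + 1 = c.val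
  | _ => True

/-- Is the gate a T-gate? -/
def Gate.isT {n : ℕ} : Gate n → Bool
  | .T _ => true
  | _ => false

/-- Hadamard matrix. -/
def hMat : Matrix Bool Bool ℂ :=
  Matrix.of fun a b => (if a && b then -1 else 1) / (Real.sqrt 2 : ℂ)

/-- The matrix `diag(1, z)`. -/
def phaseMat (z : ℂ) : Matrix Bool Bool ℂ :=
  Matrix.diagonal fun a => if a then z else 1

/-- The single-qubit matrix `u` acting on wire `i`. -/
def onWire {n : ℕ} (i : Fin n) (u : Matrix Bool Bool ℂ) :
    Matrix (Fin n → Bool) (Fin n → Bool) ℂ :=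
  Matrix.of fun x y => if ∀ j, j ≠ i → x j = y j then u (x i) (y i) else 0

/-- The unitary matrix of a gate, in the computational basis. -/
def Gate.mat {n : ℕ} : Gate n → Matrix (Fin n → Bool) (Fin n → Bool) ℂ
  | .H i => onWire i hMat
  | .S i => onWire i (phaseMat Complex.I)
  | .T i => onWire i (phaseMat (Complex.exp (Complex.I * (Real.pi / 4 : ℝ))))
  | .CNOT c t => Matrix.of fun x y => if x = Function.update y t (xor (y t) (y c)) then 1 else 0

/-- A layer of gates acting on pairwise disjoint sets of wires, two-qubit gates being nearest
neighbour. -/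
def IsLayer {n : ℕ} (L : List (Gate n)) : Prop :=
  (∀ g ∈ L, g.IsLocal) ∧ L.Pairwise fun g g' => Disjoint g.wires g'.wires

/-- The unitary matrix of a list of gates, the first gate of the list being applied first. -/
def gatesMat {n : ℕ} (L : List (Gate n)) : Matrix (Fin n → Bool) (Fin n → Bool) ℂ :=
  L.foldl (fun U g => g.mat * U) 1

/-- The output distributions `P(x) = |⟨x|U|0ⁿ⟩|²` of one-dimensional nearest-neighbour circuits on
`n` qubits with `d` layers, composed of Clifford gates and exactly one T-gate. -/
def cliffordOneT (n d : ℕ) : Set (PMF (Fin n → Bool)) :=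
  {P | ∃ C : List (List (Gate n)), C.length = d ∧ (∀ L ∈ C, IsLayer L) ∧
    C.flatten.countP Gate.isT = 1 ∧
    ∀ x, (P x).toReal = ‖gatesMat C.flatten x (fun _ => false)‖ ^ 2}

end QLearn

end

/-! The theorem is a reduction from LPN at one fixed noise rate. A single T-gate suffices to make
the noise: measuring `H T H |0⟩` gives 1 with probability sin²(π/8), which is `noiseRate`. A chain
of nearest-neighbour Clifford gates then passes a running parity along the line and leaves a
uniformly random bit on each wire it has left, so the last k + 1 wires carry a noisy parity sample
(`amplitude_parityGates`). The circuit has at most 3k + 3 gates, one per layer. If N is a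
sufficiently large power of k + D + c, with D = ⌈1/δ⌉, then d(N) exceeds this depth, and the unused
N - (k + 1) wires stay 0. LPN samples thus become samples of a distribution in the class once zeros
are put in front of them (`paddedParity_mem_cliffordOneT`, `samp_paddedParity`).

Run the learner with ε = δ = 1/N. In P, the string 0…0 x 1 has weight 2⁻ᵏη or 2⁻ᵏ(1 - η) according
to whether s·x is 0 or 1. By Markov's inequality Q agrees with P at such strings up to 2⁻ᵏ/5, except
for a fraction of at most 10/N of the x (`card_badPoints_mul_le`). At every other x, comparing the
evaluator's answer with 2⁻⁽ᵏ⁺¹⁾ yields s·x (`any_take_eq_parity`). To find s, draw x at random and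
evaluate at x with its first i bits flipped, for i = 0, …, k. Each of these points is uniform, so a
union bound applies, and consecutive parities differ by exactly the bits of s
(`xor_parity_flipBelow`). The three failure probabilities 1/N, 10(k + 1)/N and (k + 1)/N sum to at
most 1/D.

The remaining work is to write this as a program and to bound its running time. Lower bounds are
proved for `hit`, the optimal stopping value, because these compose: deterministic pieces through
`Exec`, and the learner and the evaluator as subroutines in a separate block of registers through
`runFor_mul_le_hit`. `le_hit_recoverProg` treats the recovery of s, `le_successProb_lpnProg` the
whole program, and `lpnEasy_of_efficientlyLearnable` chooses the parameters. -/

noncomputable section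
namespace QLearn

/-! ### Expectations -/

/-- Expectation of a nonnegative function. -/
def ev {α : Type*} (μ : PMF α) (f : α → ENNReal) : ENNReal := ∑' a, μ a * f a

theorem ev_pure {α : Type*} (a : α) (f : α → ENNReal) : ev (PMF.pure a) f = f a := by
  unfold ev
  rw [tsum_eq_single a]
  · simp
  · intro b hb
    simp [PMF.pure_apply, hb]

theorem ev_bind {α β : Type*} (μ : PMF α) (g : α → PMF β) (f : β → ENNReal) :
    ev (μ.bind g) f = ev μ fun a => ev (g a) f := by
  unfold ev
  simp only [PMF.bind_apply, ← ENNReal.tsum_mul_right, ← ENNReal.tsum_mul_left]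
  rw [ENNReal.tsum_comm]
  simp only [mul_assoc]

theorem ev_map {α β : Type*} (μ : PMF α) (g : α → β) (f : β → ENNReal) :
    ev (μ.map g) f = ev μ fun a => f (g a) := by
  unfold PMF.map
  rw [ev_bind]
  simp [ev_pure]

theorem ev_mono {α : Type*} (μ : PMF α) {f g : α → ENNReal} (h : ∀ a, f a ≤ g a) :
    ev μ f ≤ ev μ g :=
  ENNReal.tsum_le_tsum fun a => mul_le_mul_right (h a) _

theorem ev_const_mul {α : Type*} (μ : PMF α) (f : α → ENNReal) (c : ENNReal) :
    ev μ (fun a => f a * c) = ev μ f * c := by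
  unfold ev
  rw [← ENNReal.tsum_mul_right]
  simp only [mul_assoc]

theorem toOuterMeasure_bind_eq_ev {α β : Type*} (μ : PMF α) (g : α → PMF β) (S : Set β) :
    (μ.bind g).toOuterMeasure S = ev μ fun a => (g a).toOuterMeasure S :=
  PMF.toOuterMeasure_bind_apply _ _ _

/-! ### Optimal stopping values -/

/-- The largest expected payoff `f` that can be reached from a configuration by stopping the machine
at some time within the given number of steps. -/
def hit (O : PMF (List Bool)) (f : Config → ENNReal) : ℕ → Config → ENNReal
  | 0, c => f c
  | t + 1, c => max (f c) (ev (step O c) (hit O f t))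

section machine

variable {O : PMF (List Bool)} {f : Config → ENNReal}

theorem le_hit (t : ℕ) (c : Config) : f c ≤ hit O f t c := by
  cases t with
  | zero => exact le_rfl
  | succ t => exact le_max_left _ _

theorem ev_step_le_hit (t : ℕ) (c : Config) : ev (step O c) (hit O f t) ≤ hit O f (t + 1) c :=
  le_max_right _ _

theorem hit_le_hit_succ (t : ℕ) (c : Config) : hit O f t c ≤ hit O f (t + 1) c := by
  induction t generalizing c with
  | zero => exact le_hit _ _
  | succ t ih => exact max_le_max le_rfl (ev_mono _ ih)

theorem hit_mono_time {t t' : ℕ} (h : t ≤ t') (c : Config) : hit O f t c ≤ hit O f t' c :=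
  monotone_nat_of_le_succ (f := fun t => hit O f t c) (fun t => hit_le_hit_succ t c) h

/-- Following one stopping rule and then another is again a stopping rule, and the time limits add
up. All sequential composition of time bounds rests on this. -/
theorem hit_hit_le (t t' : ℕ) (c : Config) :
    hit O (hit O f t') t c ≤ hit O f (t + t') c := by
  induction t generalizing c with
  | zero => simp [hit]
  | succ t ih =>
    rw [Nat.succ_add]
    refine max_le (hit_mono_time (by omega) c) ?_
    exact (ev_mono _ ih).trans (ev_step_le_hit _ _)

theorem hit_of_step_pure {c c' : Config} (h : step O c = PMF.pure c') (t : ℕ) :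
    hit O f t c' ≤ hit O f (t + 1) c := by
  have := ev_step_le_hit (O := O) (f := f) t c
  rwa [h, ev_pure] at this

theorem hit_of_step_map {α : Type*} {c : Config} {μ : PMF α} {g : α → Config}
    (h : step O c = μ.map g) (t : ℕ) :
    ev μ (fun a => hit O f t (g a)) ≤ hit O f (t + 1) c := by
  have := ev_step_le_hit (O := O) (f := f) t c
  rwa [h, ev_map] at this

theorem runFor_halted (t : ℕ) (m : Mem) : runFor O t ([], m) = PMF.pure ([], m) := by
  induction t with
  | zero => rfl
  | succ t ih => simp [runFor, step, PMF.pure_bind, ih]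

/-- Reaching a halted configuration with a good output at some time is the same as having reached it
at the end. -/
theorem hit_le_successProb (A : Prog) (inputs : List (List Bool)) (t : ℕ)
    {good : List Bool → Prop} (hf1 : ∀ c, f c ≤ 1)
    (hf : ∀ c, ¬ (c.1 = [] ∧ good (c.2.reg 0)) → f c = 0) :
    hit O f t ([A], initMem inputs) ≤ successProb O A inputs t good := by
  unfold successProb
  generalize ([A], initMem inputs) = c
  -- Halted configurations are fixed by `step`, so a payoff already earned is still earned when the
  -- time runs out; elsewhere the payoff is 0.
  have key : ∀ (t : ℕ) (c : Config),
      f c ≤ (runFor O t c).toOuterMeasure {c | c.1 = [] ∧ good (c.2.reg 0)} := by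
    rintro t ⟨_ | ⟨p, K⟩, m⟩
    · rw [runFor_halted, PMF.toOuterMeasure_pure_apply]
      split_ifs with h
      · exact hf1 _
      · exact (hf _ h).le
    · rw [hf _ (by simp)]
      exact zero_le
  induction t generalizing c with
  | zero => exact key 0 c
  | succ t ih =>
    refine max_le (key _ c) ?_
    rw [runFor, toOuterMeasure_bind_eq_ev]
    exact ev_mono _ ih

/-! ### Deterministic executions -/

/-- Program `p`, started in memory `m`, ends in memory `m'` within `t` steps, without using the
oracle. -/
def Exec (p : Prog) (m : Mem) (t : ℕ) (m' : Mem) : Prop :=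
  ∀ (O : PMF (List Bool)) (f : Config → ENNReal) (K : List Prog),
    f (K, m') ≤ hit O f t (p :: K, m)

/-- This is why `Exec` quantifies over all payoffs: the payoff may be chosen as the value of the
remaining computation. -/
theorem Exec.hit_le {p : Prog} {m m' : Mem} {t : ℕ} (h : Exec p m t m') (K : List Prog) (t' : ℕ) :
    hit O f t' (K, m') ≤ hit O f (t + t') (p :: K, m) :=
  (h O (hit O f t') K).trans (hit_hit_le _ _ _)

theorem Exec.mono {p : Prog} {m m' : Mem} {t t' : ℕ} (h : Exec p m t m') (ht : t ≤ t') :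
    Exec p m t' m' :=
  fun O f K => (h O f K).trans (hit_mono_time ht _)

theorem Exec.of_step {p : Prog} {m m' : Mem}
    (h : ∀ O K, step O (p :: K, m) = PMF.pure (K, m')) : Exec p m 1 m' :=
  fun O _ K => hit_of_step_pure (t := 0) (h O K)

theorem Exec.of_step_cons {p q : Prog} {m m' : Mem} {t : ℕ} (hq : Exec q m t m')
    (h : ∀ O K, step O (p :: K, m) = PMF.pure (q :: K, m)) : Exec p m (t + 1) m' :=
  fun O f K => (hq O f K).trans (hit_of_step_pure (h O K) t)

theorem exec_push (r : ℕ) (b : Bool) (m : Mem) :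
    Exec (.push r b) m 1 (m.set r (b :: m.reg r)) := .of_step fun _ _ => rfl

theorem exec_pop (r : ℕ) (m : Mem) : Exec (.pop r) m 1 (m.set r (m.reg r).tail) :=
  .of_step fun _ _ => rfl

theorem exec_clear (r : ℕ) (m : Mem) : Exec (.clear r) m 1 (m.set r []) := .of_step fun _ _ => rfl

theorem Exec.seq {p q : Prog} {m m₁ m₂ : Mem} {t t' : ℕ} (hp : Exec p m t m₁)
    (hq : Exec q m₁ t' m₂) : Exec (.seq p q) m (t + t' + 1) m₂ := by
  intro O f K
  have h1 := (hq O f K).trans (hp.hit_le (q :: K) t')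
  exact h1.trans (hit_of_step_pure (c := (Prog.seq p q :: K, m)) rfl _)

theorem Exec.cond_nil {r : ℕ} {e p q : Prog} {m m' : Mem} {t : ℕ} (hr : m.reg r = [])
    (h : Exec e m t m') : Exec (.cond r e p q) m (t + 1) m' :=
  h.of_step_cons fun O K => by simp [step, hr]

theorem Exec.cond_true {r : ℕ} {e p q : Prog} {m m' : Mem} {t : ℕ} {l : List Bool}
    (hr : m.reg r = true :: l) (h : Exec p m t m') : Exec (.cond r e p q) m (t + 1) m' :=
  h.of_step_cons fun O K => by simp [step, hr]

theorem Exec.cond_false {r : ℕ} {e p q : Prog} {m m' : Mem} {t : ℕ} {l : List Bool}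
    (hr : m.reg r = false :: l) (h : Exec q m t m') : Exec (.cond r e p q) m (t + 1) m' :=
  h.of_step_cons fun O K => by simp [step, hr]

theorem Exec.loop_nil {r : ℕ} {p : Prog} {m : Mem} (hr : m.reg r = []) :
    Exec (.loop r p) m 1 m :=
  .of_step fun O K => by simp [step, hr]

theorem step_loop_cons {r : ℕ} {p : Prog} {m : Mem} (hr : m.reg r ≠ []) (K : List Prog) :
    step O (.loop r p :: K, m) = PMF.pure (p :: .loop r p :: K, m) := by
  obtain ⟨b, l, h⟩ := List.exists_cons_of_ne_nil hr
  simp [step, h]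

theorem Exec.loop_cons {r : ℕ} {p : Prog} {m m₁ m₂ : Mem} {t t' : ℕ} (hr : m.reg r ≠ [])
    (hp : Exec p m t m₁) (hl : Exec (.loop r p) m₁ t' m₂) :
    Exec (.loop r p) m (t + t' + 1) m₂ := by
  intro O f K
  have h1 := (hl O f K).trans (hp.hit_le (.loop r p :: K) t')
  exact h1.trans (hit_of_step_pure (step_loop_cons hr K) _)

/-- A loop whose body is executed `n` times, passing through the memories `ms n, …, ms 0`. -/
theorem Exec.loop_iterate {r : ℕ} {p : Prog} {t : ℕ} (ms : ℕ → Mem) (n : ℕ)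
    (h0 : (ms 0).reg r = []) (hne : ∀ i < n, (ms (i + 1)).reg r ≠ [])
    (hp : ∀ i < n, Exec p (ms (i + 1)) t (ms i)) :
    Exec (.loop r p) (ms n) (n * (t + 1) + 1) (ms 0) := by
  induction n with
  | zero => simpa using Exec.loop_nil h0
  | succ n ih =>
    have := Exec.loop_cons (hne n (by omega)) (hp n (by omega))
      (ih (fun i hi => hne i (by omega)) (fun i hi => hp i (by omega)))
    exact this.mono (by linarith)

end machine

/-! ### Memories -/

theorem Mem.ext' {m m' : Mem} (h : ∀ r, m.reg r = m'.reg r) (hq : m.qmem = m'.qmem) : m = m' := by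
  cases m; cases m'; simp only [Mem.mk.injEq]; exact ⟨funext h, hq⟩

@[simp] theorem Mem.set_reg (m : Mem) (r : ℕ) (l : List Bool) (i : ℕ) :
    (m.set r l).reg i = if i = r then l else m.reg i := by
  simp [Mem.set, Function.update_apply]

@[simp] theorem Mem.set_qmem (m : Mem) (r : ℕ) (l : List Bool) : (m.set r l).qmem = m.qmem := rfl

/-- The memory in which the registers below `B` are given by `a` and the registers from `B` on by the
list `ls`. -/
def memOf (B : ℕ) (a : ℕ → List Bool) (q : QState) (ls : List (List Bool)) : Mem where
  reg := fun r => if r < B then a r else ls.getD (r - B) []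
  qmem := q

section memOf
variable {B : ℕ} {a : ℕ → List Bool} {q : QState} {ls : List (List Bool)}

theorem memOf_reg_low {r : ℕ} (h : r < B) : (memOf B a q ls).reg r = a r := by
  simp [memOf, h]

@[simp] theorem memOf_reg_high (i : ℕ) : (memOf B a q ls).reg (B + i) = ls.getD i [] := by
  simp [memOf]

theorem memOf_set_low {r : ℕ} (h : r < B) (l : List Bool) :
    (memOf B a q ls).set r l = memOf B (Function.update a r l) q ls := by
  refine Mem.ext' (fun i => ?_) rfl
  by_cases hi : i = r
  · subst hi; simp [memOf, h]
  · simp [memOf, hi, Function.update_apply]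

theorem memOf_set_high {i : ℕ} (h : i < ls.length) (l : List Bool) :
    (memOf B a q ls).set (B + i) l = memOf B a q (ls.set i l) := by
  refine Mem.ext' (fun j => ?_) rfl
  by_cases hj : j = B + i
  · subst hj; simp [memOf, h]
  · by_cases hB : j < B
    · simp [memOf, hj, hB]
    · simp only [Mem.set_reg, hj, if_false, memOf, hB]
      rw [List.getD_eq_getElem?_getD, List.getD_eq_getElem?_getD, List.getElem?_set_ne (by omega)]

theorem memOf_congr {a' : ℕ → List Bool} (h : ∀ r < B, a r = a' r) :
    memOf B a q ls = memOf B a' q ls := by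
  refine Mem.ext' (fun r => ?_) rfl
  by_cases hr : r < B
  · simp [memOf, hr, h r hr]
  · simp [memOf, hr]

end memOf

/-! ### Copying registers -/

/-- Pop the content of `s` and push it onto `d`. -/
def moveTo (s d : ℕ) : Prog :=
  .loop s (.cond s (.pop s) (.seq (.push d true) (.pop s)) (.seq (.push d false) (.pop s)))

/-- Pop the content of `s` and push it onto both `d` and `d'`. -/
def moveToBoth (s d d' : ℕ) : Prog :=
  .loop s (.cond s (.pop s) (.seq (.push d true) (.seq (.push d' true) (.pop s)))
    (.seq (.push d false) (.seq (.push d' false) (.pop s))))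

theorem exec_moveTo {s d : ℕ} (hsd : s ≠ d) (m : Mem) :
    Exec (moveTo s d) m (5 * (m.reg s).length + 1)
      ((m.set d ((m.reg s).reverse ++ m.reg d)).set s []) := by
  generalize hl : m.reg s = l
  induction l generalizing m with
  | nil =>
    have : (m.set d (([] : List Bool).reverse ++ m.reg d)).set s [] = m :=
      Mem.ext' (fun i => by by_cases h : i = s <;> simp +contextual [h, hl]) rfl
    rw [this]
    exact (Exec.loop_nil hl).mono (by simp)
  | cons b l ih =>
    have hbody : Exec (.cond s (.pop s) (.seq (.push d true) (.pop s))
        (.seq (.push d false) (.pop s))) m 4 ((m.set d (b :: m.reg d)).set s l) := by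
      have h1 := (exec_push d b m).seq (exec_pop s _)
      have h2 : ((m.set d (b :: m.reg d)).reg s).tail = l := by simp [hsd, hl]
      rw [h2] at h1
      cases b
      · exact Exec.cond_false hl h1
      · exact Exec.cond_true hl h1
    have h3 := Exec.loop_cons (by simp [hl]) hbody (ih ((m.set d (b :: m.reg d)).set s l) (by simp))
    refine Eq.mp ?_ (h3.mono (t' := 5 * (b :: l).length + 1) (by simp; omega))
    congr 1
    refine Mem.ext' (fun i => ?_) rfl
    by_cases h : i = s
    · simp [h]
    · by_cases h' : i = d <;> simp [h, h', hsd.symm]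

theorem exec_moveToBoth {s d d' : ℕ} (hsd : s ≠ d) (hsd' : s ≠ d') (hdd : d ≠ d') (m : Mem) :
    Exec (moveToBoth s d d') m (7 * (m.reg s).length + 1)
      (((m.set d ((m.reg s).reverse ++ m.reg d)).set d' ((m.reg s).reverse ++ m.reg d')).set s
        []) := by
  generalize hl : m.reg s = l
  induction l generalizing m with
  | nil =>
    have : ((m.set d (([] : List Bool).reverse ++ m.reg d)).set d'
        (([] : List Bool).reverse ++ m.reg d')).set s [] = m := by
      refine Mem.ext' (fun i => ?_) rfl
      by_cases h : i = s
      · simp [h, hl]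
      · by_cases h' : i = d
        · simp [h', hdd, hsd.symm]
        · by_cases h'' : i = d' <;> simp [h, h', h'', hsd'.symm]
    rw [this]
    exact (Exec.loop_nil hl).mono (by simp)
  | cons b l ih =>
    have hbody : Exec (.cond s (.pop s) (.seq (.push d true) (.seq (.push d' true) (.pop s)))
        (.seq (.push d false) (.seq (.push d' false) (.pop s)))) m 6
        (((m.set d (b :: m.reg d)).set d' (b :: m.reg d')).set s l) := by
      have h1 := (exec_push d b m).seq ((exec_push d' b _).seq (exec_pop s _))
      have h2 : (((m.set d (b :: m.reg d)).set d' (b :: (m.set d (b :: m.reg d)).reg d')).reg s).tail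
          = l := by simp [hsd, hsd', hl]
      rw [h2] at h1
      have h4 : (m.set d (b :: m.reg d)).reg d' = m.reg d' := by simp [hdd.symm]
      rw [h4] at h1
      cases b
      · exact Exec.cond_false hl h1
      · exact Exec.cond_true hl h1
    have h3 := Exec.loop_cons (by simp [hl]) hbody (ih _ (by simp))
    refine Eq.mp ?_ (h3.mono (t' := 7 * (b :: l).length + 1) (by simp; omega))
    congr 1
    refine Mem.ext' (fun i => ?_) rfl
    by_cases h : i = s
    · simp [h]
    · by_cases h' : i = d
      · simp [h', hsd.symm, hdd]
      · by_cases h'' : i = d' <;> simp [h, h', h'', hsd'.symm]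

/-- Put a copy of the content of `s` on top of `d`, using the empty register `t`. -/
def prepend (s d t : ℕ) : Prog := .seq (moveTo s t) (moveToBoth t s d)

/-- Put a copy of the reversed content of `s` on top of `d`, using the empty register `t`. -/
def prependReverse (s d t : ℕ) : Prog := .seq (moveToBoth s t d) (moveTo t s)

/-- Each pass through a stack reverses the content. After two passes `s` is restored and the copy
has the original order; the cost is 5ℓ + 1 and 7ℓ + 1 for the passes, and 1 for the composition. -/
theorem exec_prepend {s d t : ℕ} (hsd : s ≠ d) (hst : s ≠ t) (hdt : d ≠ t) (m : Mem)
    (ht : m.reg t = []) :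
    Exec (prepend s d t) m (12 * (m.reg s).length + 3) (m.set d (m.reg s ++ m.reg d)) := by
  have h1 := exec_moveTo hst m
  have h2 := h1.seq (exec_moveToBoth hst.symm hdt.symm hsd _)
  refine Eq.mp ?_ (h2.mono (t' := 12 * (m.reg s).length + 3) ?_)
  · congr 1
    refine Mem.ext' (fun i => ?_) rfl
    by_cases h : i = t
    · simp [h, hdt.symm, ht]
    · by_cases h' : i = d
      · simp [h', hsd.symm, hdt, ht, hst.symm]
      · by_cases h'' : i = s <;> simp [h, h', h'', ht, hst, hst.symm, hsd]
  · simp [ht, hst.symm]; omega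

/-- Here the copy is made during the first pass, hence is reversed, while `s` is restored by the
second. -/
theorem exec_prependReverse {s d t : ℕ} (hsd : s ≠ d) (hst : s ≠ t) (hdt : d ≠ t) (m : Mem)
    (ht : m.reg t = []) :
    Exec (prependReverse s d t) m (12 * (m.reg s).length + 3)
      (m.set d ((m.reg s).reverse ++ m.reg d)) := by
  have h1 := exec_moveToBoth hst hsd hdt.symm m
  have h2 := h1.seq (exec_moveTo hst.symm _)
  refine Eq.mp ?_ (h2.mono (t' := 12 * (m.reg s).length + 3) ?_)
  · congr 1
    refine Mem.ext' (fun i => ?_) rfl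
    by_cases h : i = t
    · simp [h, hdt.symm, ht]
    · by_cases h' : i = d
      · simp [h', hsd.symm, hdt]
      · by_cases h'' : i = s <;> simp [h, h', h'', ht, hst, hst.symm, hsd, hdt.symm]
  · simp [ht, hst.symm, hdt.symm]; omega


/-! ### Running a program as a subroutine -/

/-- All registers that the program mentions are below this number. -/
def Prog.bound : Prog → ℕ
  | .push r _ => r + 1
  | .pop r => r + 1
  | .clear r => r + 1
  | .seq p q => max p.bound q.bound
  | .cond r e p q => max (r + 1) (max e.bound (max p.bound q.bound))
  | .loop r p => max (r + 1) p.bound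
  | .coin r => r + 1
  | .sample r => r + 1
  | .qreset => 0
  | .had r => r + 1
  | .tgate r => r + 1
  | .cnot r r' => max (r + 1) (r' + 1)
  | .meas r r' => max (r + 1) (r' + 1)

/-- Replace each query to the sample oracle by the program `pad r`, where `r` is the register for the
answer. -/
def Prog.replaceSample (pad : ℕ → Prog) : Prog → Prog
  | .seq p q => .seq (p.replaceSample pad) (q.replaceSample pad)
  | .cond r e p q => .cond r (e.replaceSample pad) (p.replaceSample pad) (q.replaceSample pad)
  | .loop r p => .loop r (p.replaceSample pad)
  | .sample r => pad r
  | p => p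

theorem Prog.IsClassical.replaceSample {pad : ℕ → Prog} (hpad : ∀ r, (pad r).IsClassical)
    {p : Prog} (hp : p.IsClassical) : (p.replaceSample pad).IsClassical := by
  induction p with
  | seq p q ihp ihq => exact ⟨ihp hp.1, ihq hp.2⟩
  | cond r e p q ihe ihp ihq => exact ⟨ihe hp.1, ihp hp.2.1, ihq hp.2.2⟩
  | loop r p ih => exact ih hp
  | sample r => exact hpad r
  | _ => exact hp

section simulation

variable {B : ℕ} {ls : List (List Bool)}

/-- The memory `m` of a subroutine, embedded into a larger memory. -/
def Mem.embed (B : ℕ) (ls : List (List Bool)) (m : Mem) : Mem := memOf B m.reg m.qmem ls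

theorem Mem.embed_reg {m : Mem} {r : ℕ} (h : r < B) : (m.embed B ls).reg r = m.reg r :=
  memOf_reg_low h

theorem Mem.embed_set {m : Mem} {r : ℕ} (h : r < B) (l : List Bool) :
    (m.embed B ls).set r l = (m.set r l).embed B ls :=
  memOf_set_low h l

theorem toOuterMeasure_runFor_succ_of_pure {O : PMF (List Bool)} {c c' : Config} {t : ℕ}
    (h : step O c = PMF.pure c') (S : Set Config) :
    (runFor O (t + 1) c).toOuterMeasure S = (runFor O t c').toOuterMeasure S := by
  rw [runFor, h, PMF.pure_bind]

theorem toOuterMeasure_runFor_succ_of_map {O : PMF (List Bool)} {α : Type*} {c : Config}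
    {μ : PMF α} {g : α → Config} {t : ℕ} (h : step O c = μ.map g) (S : Set Config) :
    (runFor O (t + 1) c).toOuterMeasure S = ev μ fun a => (runFor O t (g a)).toOuterMeasure S := by
  rw [runFor, h, PMF.bind_map, toOuterMeasure_bind_eq_ev]
  rfl

/-- A run of a program in its own memory with the sample oracle `O'` is simulated in a larger memory
with the oracle `O` if every query to `O'` can be simulated. -/
theorem runFor_mul_le_hit {O O' : PMF (List Bool)} {pad : ℕ → Prog} {cost : ℕ} (hcost : 1 ≤ cost)
    (hpad : ∀ r < B, ∀ (m : Mem) (f : Config → ENNReal) (K : List Prog),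
      ev O' (fun l => f (K, (m.set r l).embed B ls)) ≤ hit O f cost (pad r :: K, m.embed B ls))
    {I : QState → Prop} {K : List Prog} {f : Config → ENNReal} {G : Mem → Prop} {a : ENNReal}
    (hf : ∀ m, G m → I m.qmem → a ≤ f (K, m.embed B ls)) (t : ℕ) (KA : List Prog) (m : Mem)
    (hK : ∀ p ∈ KA, p.bound ≤ B ∧ (p.IsClassical ∨ ∀ q, I q)) (hI : I m.qmem) :
    (runFor O' t (KA, m)).toOuterMeasure {c | c.1 = [] ∧ G c.2} * a ≤
      hit O f (cost * t) (KA.map (Prog.replaceSample pad) ++ K, m.embed B ls) := by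
  have halt : ∀ m t, I m.qmem → (runFor O' t ([], m)).toOuterMeasure {c | c.1 = [] ∧ G c.2} * a ≤
      hit O f (cost * t) (K, m.embed B ls) := by
    intro m t hI
    rw [runFor_halted, PMF.toOuterMeasure_pure_apply]
    split_ifs with h
    · rw [one_mul]
      exact (hf m h.2 hI).trans (le_hit _ _)
    · simp
  induction t generalizing KA m with
  | zero =>
    cases KA with
    | nil => exact halt m 0 hI
    | cons p KA =>
      rw [runFor, PMF.toOuterMeasure_pure_apply, if_neg (by simp)]
      simp
  | succ t ih =>
    cases KA with
    | nil => exact halt m _ hI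
    | cons p KA =>
      obtain ⟨hb, hcl⟩ := hK p (by simp)
      have hKA : ∀ p ∈ KA, p.bound ≤ B ∧ (p.IsClassical ∨ ∀ q, I q) :=
        fun p hp => hK p (by simp [hp])
      have htime : cost * t + 1 ≤ cost * (t + 1) := by rw [mul_add]; omega
      -- Every instruction other than a query is simulated by itself, because all registers it
      -- mentions are below `B`. It uses one step of the `cost` granted to it.
      have hpure : ∀ (KA' : List Prog) (m' : Mem),
          (∀ p ∈ KA', p.bound ≤ B ∧ (p.IsClassical ∨ ∀ q, I q)) → I m'.qmem →
          step O' (p :: KA, m) = PMF.pure (KA', m') →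
          step O (p.replaceSample pad :: (KA.map (Prog.replaceSample pad) ++ K), m.embed B ls) =
            PMF.pure (KA'.map (Prog.replaceSample pad) ++ K, m'.embed B ls) →
          (runFor O' (t + 1) (p :: KA, m)).toOuterMeasure {c | c.1 = [] ∧ G c.2} * a ≤
            hit O f (cost * (t + 1))
              ((p :: KA).map (Prog.replaceSample pad) ++ K, m.embed B ls) := by
        intro KA' m' h1 h2 h3 h4
        rw [toOuterMeasure_runFor_succ_of_pure h3]
        exact (ih KA' m' h1 h2).trans ((hit_of_step_pure h4 _).trans (hit_mono_time htime _))
      have hmap : ∀ (μ : PMF Bool) (g : Bool → Mem),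
          (∀ b, I (g b).qmem) →
          step O' (p :: KA, m) = μ.map (fun b => (KA, g b)) →
          step O (p.replaceSample pad :: (KA.map (Prog.replaceSample pad) ++ K), m.embed B ls) =
            μ.map (fun b => (KA.map (Prog.replaceSample pad) ++ K, (g b).embed B ls)) →
          (runFor O' (t + 1) (p :: KA, m)).toOuterMeasure {c | c.1 = [] ∧ G c.2} * a ≤
            hit O f (cost * (t + 1))
              ((p :: KA).map (Prog.replaceSample pad) ++ K, m.embed B ls) := by
        intro μ g h2 h3 h4
        rw [toOuterMeasure_runFor_succ_of_map h3, ← ev_const_mul]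
        exact (ev_mono _ fun b => ih KA (g b) hKA (h2 b)).trans
          ((hit_of_step_map h4 _).trans (hit_mono_time htime _))
      cases p with
      | push r b =>
        have hr : r < B := hb
        refine hpure KA _ hKA ?_ rfl ?_
        · exact hI
        · simp [step, Prog.replaceSample, Mem.embed_set hr, Mem.embed_reg hr]
      | pop r =>
        have hr : r < B := hb
        refine hpure KA _ hKA ?_ rfl ?_
        · exact hI
        · simp [step, Prog.replaceSample, Mem.embed_set hr, Mem.embed_reg hr]
      | clear r =>
        have hr : r < B := hb
        refine hpure KA _ hKA ?_ rfl ?_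
        · exact hI
        · simp [step, Prog.replaceSample, Mem.embed_set hr]
      | seq p q =>
        simp only [Prog.bound, max_le_iff] at hb
        simp only [Prog.IsClassical] at hcl
        refine hpure (p :: q :: KA) m ?_ hI rfl ?_
        · simp only [List.mem_cons]
          rintro _ (rfl | rfl | h)
          · exact ⟨hb.1, hcl.imp_left And.left⟩
          · exact ⟨hb.2, hcl.imp_left And.right⟩
          · exact hKA _ h
        · simp [step, Prog.replaceSample]
      | cond r e p q =>
        simp only [Prog.bound, max_le_iff] at hb
        simp only [Prog.IsClassical] at hcl
        have hr : r < B := hb.1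
        have hreg := Mem.embed_reg (ls := ls) (m := m) hr
        have hmem : ∀ x : Prog, x.bound ≤ B → (x.IsClassical ∨ ∀ q, I q) →
            ∀ p ∈ x :: KA, p.bound ≤ B ∧ (p.IsClassical ∨ ∀ q, I q) := by
          intro x hx hx'
          simp only [List.mem_cons]
          rintro _ (rfl | h)
          · exact ⟨hx, hx'⟩
          · exact hKA _ h
        rcases h : m.reg r with _ | ⟨_ | _, l⟩
        · exact hpure (e :: KA) m (hmem e hb.2.1 (hcl.imp_left And.left)) hI (by simp [step, h])
            (by simp [step, Prog.replaceSample, hreg, h])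
        · exact hpure (q :: KA) m (hmem q hb.2.2.2 (hcl.imp_left fun h => h.2.2)) hI
            (by simp [step, h]) (by simp [step, Prog.replaceSample, hreg, h])
        · exact hpure (p :: KA) m (hmem p hb.2.2.1 (hcl.imp_left fun h => h.2.1)) hI
            (by simp [step, h]) (by simp [step, Prog.replaceSample, hreg, h])
      | loop r p =>
        have hb' := hb
        simp only [Prog.bound, max_le_iff] at hb'
        have hr : r < B := hb'.1
        have hreg := Mem.embed_reg (ls := ls) (m := m) hr
        rcases h : m.reg r with _ | ⟨b, l⟩
        · exact hpure KA m hKA hI (by simp [step, h])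
            (by simp [step, Prog.replaceSample, hreg, h])
        · refine hpure (p :: .loop r p :: KA) m ?_ hI (by simp [step, h])
            (by simp [step, Prog.replaceSample, hreg, h])
          simp only [List.mem_cons]
          rintro _ (rfl | rfl | h)
          · exact ⟨hb'.2, hcl⟩
          · exact ⟨hb, hcl⟩
          · exact hKA _ h
      | coin r =>
        have hr : r < B := hb
        refine hmap (biasedBit (1 / 2)) (fun b => m.set r (b :: m.reg r)) (fun _ => hI) rfl ?_
        simp [step, Prog.replaceSample, Mem.embed_set hr, Mem.embed_reg hr]
      | sample r =>
        have hr : r < B := hb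
        rw [toOuterMeasure_runFor_succ_of_map (g := fun l => (KA, m.set r l)) (μ := O') rfl,
          ← ev_const_mul, mul_add, mul_one, add_comm]
        refine (ev_mono _ fun l => ih KA (m.set r l) hKA hI).trans ?_
        -- The simulated query is charged `cost`, and its payoff is the value of the rest of the run
        -- within `cost * t`.
        refine (hpad r hr m (hit O f (cost * t)) _).trans (hit_hit_le _ _ _)
      | qreset =>
        -- A quantum instruction may destroy any invariant of the quantum memory, but it is not
        -- classical, so `I` is known to hold of every state.
        have hI' : ∀ q, I q := hcl.resolve_left (by simp [Prog.IsClassical])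
        exact hpure KA _ hKA (hI' _) rfl rfl
      | had r =>
        have hr : r < B := hb
        have hI' : ∀ q, I q := hcl.resolve_left (by simp [Prog.IsClassical])
        refine hpure KA _ hKA (hI' _) rfl ?_
        simp [step, Prog.replaceSample, Mem.embed, memOf, hr]
      | tgate r =>
        have hr : r < B := hb
        have hI' : ∀ q, I q := hcl.resolve_left (by simp [Prog.IsClassical])
        refine hpure KA _ hKA (hI' _) rfl ?_
        simp [step, Prog.replaceSample, Mem.embed, memOf, hr]
      | cnot r r' =>
        simp only [Prog.bound, max_le_iff, Nat.add_one_le_iff] at hb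
        have hI' : ∀ q, I q := hcl.resolve_left (by simp [Prog.IsClassical])
        refine hpure KA _ hKA (hI' _) rfl ?_
        simp [step, Prog.replaceSample, Mem.embed, memOf, hb.1, hb.2]
      | meas r r' =>
        simp only [Prog.bound, max_le_iff, Nat.add_one_le_iff] at hb
        have hI' : ∀ q, I q := hcl.resolve_left (by simp [Prog.IsClassical])
        refine hmap (biasedBit (m.qmem.probOne (m.reg r).length))
          (fun b => ⟨Function.update m.reg r' (b :: m.reg r'), m.qmem.proj (m.reg r).length b⟩)
          (fun _ => hI' _) rfl ?_
        have hset : ∀ b, (⟨Function.update (m.embed B ls).reg r' (b :: m.reg r'),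
            m.qmem.proj (m.reg r).length b⟩ : Mem) =
            Mem.embed B ls ⟨Function.update m.reg r' (b :: m.reg r'),
              m.qmem.proj (m.reg r).length b⟩ := by
          intro b
          have := congrArg Mem.reg (Mem.embed_set (ls := ls) (m := m) hb.2 (b :: m.reg r'))
          exact Mem.ext' (fun i => congrFun this i) rfl
        simp only [step, Prog.replaceSample, Mem.embed_reg hb.1, Mem.embed_reg hb.2]
        exact congrArg (fun g => PMF.map g _) (funext fun b => congrArg (Prod.mk _) (hset b))

end simulation

/-! ### Amplitudes of circuits -/

/-- The amplitude `⟨z|U|0ⁿ⟩` of the circuit `U` given by a list of gates. -/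
def amplitude {n : ℕ} (L : List (Gate n)) (z : Fin n → Bool) : ℂ :=
  gatesMat L z (fun _ => false)

section amplitude
variable {n : ℕ} (L : List (Gate n)) (z : Fin n → Bool)

theorem amplitude_nil : amplitude [] z = if z = fun _ => false then 1 else 0 := by
  simp [amplitude, gatesMat, Matrix.one_apply]

theorem amplitude_append_gate (g : Gate n) :
    amplitude (L ++ [g]) z = ∑ y, g.mat z y * amplitude L y := by
  simp [amplitude, gatesMat, List.foldl_append, Matrix.mul_apply]

/-- A row of `onWire i u` is supported on the two strings that agree with `z` away from wire `i`. -/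
theorem sum_onWire_mul (i : Fin n) (u : Matrix Bool Bool ℂ) (φ : (Fin n → Bool) → ℂ) :
    ∑ y, onWire i u z y * φ y = ∑ b, u (z i) b * φ (Function.update z i b) := by
  have h : ∀ y, onWire i u z y * φ y =
      ∑ b, if y = Function.update z i b then u (z i) b * φ y else 0 := by
    intro y
    have key : (∀ j, j ≠ i → z j = y j) ↔ y = Function.update z i (y i) := by
      constructor
      · intro h
        funext j
        by_cases hj : j = i
        · subst hj; simp
        · simp [hj, h j hj]
      · intro h j hj
        rw [h]
        simp [hj]
    rw [Finset.sum_eq_single (y i)]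
    · simp only [onWire, Matrix.of_apply, key]
      split_ifs <;> simp
    · intro b _ hb
      rw [if_neg]
      intro h
      apply hb
      rw [h]; simp
    · simp
  simp_rw [h]
  rw [Finset.sum_comm]
  simp

theorem amplitude_H (i : Fin n) : amplitude (L ++ [.H i]) z =
    (amplitude L (Function.update z i false) +
      (if z i then -1 else 1) * amplitude L (Function.update z i true)) / (Real.sqrt 2 : ℂ) := by
  rw [amplitude_append_gate, Gate.mat, sum_onWire_mul]
  cases h : z i <;> simp [hMat] <;> ring

theorem amplitude_T (i : Fin n) : amplitude (L ++ [.T i]) z =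
    (if z i then Complex.exp (Complex.I * (Real.pi / 4 : ℝ)) else 1) * amplitude L z := by
  rw [amplitude_append_gate, Gate.mat, sum_onWire_mul]
  have := Function.update_eq_self i z
  cases h : z i <;> rw [h] at this <;> simp [phaseMat, this]

/-- For distinct wires CNOT is an involution on basis strings, so the preimage of `z` is computed by
the same update. -/
theorem amplitude_CNOT {c t : Fin n} (hct : c ≠ t) : amplitude (L ++ [.CNOT c t]) z =
    amplitude L (Function.update z t (xor (z t) (z c))) := by
  rw [amplitude_append_gate, Gate.mat,
    Finset.sum_eq_single (Function.update z t (xor (z t) (z c)))]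
  · simp [hct]
  · intro y _ hy
    rw [Matrix.of_apply, if_neg, zero_mul]
    intro h
    apply hy
    rw [h]
    simp [hct]
  · simp

end amplitude

/-! ### A circuit for noisy parities -/

/-- The amplitudes of the state `H T H |0⟩`. -/
def noiseAmp (b : Bool) : ℂ :=
  (1 + (if b then -1 else 1) * Complex.exp (Complex.I * (Real.pi / 4 : ℝ))) / 2

/-- The noise rate `sin² (π/8)`. -/
def noiseRate : ℝ := (1 - Real.sqrt 2 / 2) / 2

/-- |1 ± e^{iθ}|²/4 = (1 ± cos θ)/2 with θ = π/4. -/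
theorem normSq_noiseAmp (b : Bool) :
    ‖noiseAmp b‖ ^ 2 = if b then noiseRate else 1 - noiseRate := by
  have h2 : Real.sqrt 2 ^ 2 = 2 := Real.sq_sqrt (by norm_num)
  have he : Complex.exp (Complex.I * (Real.pi / 4 : ℝ)) =
      ((Real.sqrt 2 / 2 : ℝ) : ℂ) + ((Real.sqrt 2 / 2 : ℝ) : ℂ) * Complex.I := by
    rw [mul_comm, Complex.exp_mul_I, ← Complex.ofReal_cos, ← Complex.ofReal_sin,
      Real.cos_pi_div_four, Real.sin_pi_div_four]
  rw [← Complex.normSq_eq_norm_sq, noiseAmp, he, Complex.normSq_apply]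
  cases b
  · simp [noiseRate]
    nlinarith
  · simp [noiseRate]
    nlinarith

/-- Gates that swap the qubit `a` with a fresh uniformly random bit `b` and then add the random bit
to the second one if `s` holds. -/
def absorbGates {n : ℕ} (a b : Fin n) (s : Bool) : List (Gate n) :=
  [.H b, .CNOT b a] ++ if s then [] else [.CNOT a b]

/-- Gates that prepare uniformly random bits on the `k` wires from `p` on, followed by their noisy
parity. -/
def parityGates {n : ℕ} (p : ℕ) (s : ℕ → Bool) : (k : ℕ) → p + k < n → List (Gate n)
  | 0, h => [.H ⟨p, h⟩, .T ⟨p, h⟩, .H ⟨p, h⟩]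
  | k + 1, h => parityGates p s k (by omega) ++ absorbGates ⟨p + k, by omega⟩ ⟨p + (k + 1), h⟩ (s k)

/-- Let `a` hold y and `b` hold 0. The Hadamard gate gives `b` a uniform bit r, and the first CNOT
turns `a` into x = y ⊕ r, again uniform, while `b` holds r = y ⊕ x. If `s` is false, the second CNOT
removes x from `b`. The formula reads this backwards; `hL`, which says that `b` is still 0, kills
the branch on which the Hadamard gate has a sign. -/
theorem amplitude_absorbGates {n : ℕ} (L : List (Gate n)) {a b : Fin n} (hab : a ≠ b) (s : Bool)
    (hL : ∀ y, y b = true → amplitude L y = 0) (z : Fin n → Bool) :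
    amplitude (L ++ absorbGates a b s) z = 1 / (Real.sqrt 2 : ℂ) *
      amplitude L (Function.update (Function.update z a (xor (z b) (s && z a))) b false) := by
  have h1 : ∀ z, amplitude (L ++ [.H b]) z =
      1 / (Real.sqrt 2 : ℂ) * amplitude L (Function.update z b false) := by
    intro z
    rw [amplitude_H, hL (Function.update z b true) (by simp)]
    ring
  have h2 : ∀ z, amplitude (L ++ [.H b] ++ [.CNOT b a]) z = 1 / (Real.sqrt 2 : ℂ) *
      amplitude L (Function.update (Function.update z a (xor (z a) (z b))) b false) := by
    intro z
    rw [amplitude_CNOT _ _ hab.symm, h1]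
  cases s
  · have h3 : L ++ absorbGates a b false = L ++ [.H b] ++ [.CNOT b a] ++ [.CNOT a b] := by
      simp [absorbGates]
    rw [h3, amplitude_CNOT _ _ hab, h2]
    congr 2
    funext j
    by_cases hj : j = b
    · simp [hj]
    · by_cases hj' : j = a
      · subst hj'
        simp only [Function.update_apply, hj, if_false, if_true]
        cases z j <;> cases z b <;> rfl
      · simp [hj, hj']
  · have h3 : L ++ absorbGates a b true = L ++ [.H b] ++ [.CNOT b a] := by
      simp [absorbGates]
    rw [h3, h2, Bool.true_and, Bool.xor_comm]

/-- The parity of the bits selected by `s` among the first `k` bits of `x`. -/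
def parityBelow (s x : ℕ → Bool) (k : ℕ) : Bool :=
  decide (Odd (∑ i ∈ Finset.range k, if s i = true ∧ x i = true then 1 else 0))

theorem parityBelow_succ (s x : ℕ → Bool) (k : ℕ) :
    parityBelow s x (k + 1) = xor (parityBelow s x k) (s k && x k) := by
  unfold parityBelow
  rw [Finset.sum_range_succ]
  cases h1 : s k <;> cases h2 : x k <;>
    simp [Nat.odd_add_one, -Nat.not_odd_iff_even]

theorem parityBelow_congr {s s' x x' : ℕ → Bool} {k : ℕ} (hs : ∀ i < k, s i = s' i)
    (hx : ∀ i < k, x i = x' i) : parityBelow s x k = parityBelow s' x' k := by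
  unfold parityBelow
  have : ∑ i ∈ Finset.range k, (if s i = true ∧ x i = true then 1 else 0) =
      ∑ i ∈ Finset.range k, if s' i = true ∧ x' i = true then 1 else 0 :=
    Finset.sum_congr rfl fun i hi => by
      rw [hs i (Finset.mem_range.1 hi), hx i (Finset.mem_range.1 hi)]
  simp only [this]

/-- Extend a bit string by zeros. -/
def extendZero {n : ℕ} (x : Fin n → Bool) (i : ℕ) : Bool := if h : i < n then x ⟨i, h⟩ else false

theorem extendZero_of_lt {n : ℕ} (x : Fin n → Bool) {i : ℕ} (h : i < n) :
    extendZero x i = x ⟨i, h⟩ := dif_pos h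

theorem parity_eq_parityBelow {k : ℕ} (s x : Fin k → Bool) :
    parity s x = parityBelow (extendZero s) (extendZero x) k := by
  unfold parity parityBelow
  congr 2
  rw [Finset.card_filter, ← Fin.sum_univ_eq_sum_range
    (fun i => if extendZero s i = true ∧ extendZero x i = true then 1 else 0)]
  simp [extendZero]

/-- The invariant of the chain: wires `p` to `p + k - 1` are uniform, each contributing 1/√2, and
wire `p + k` holds their parity plus the noise bit. Since the CNOT gates only permute basis strings
and every later Hadamard gate acts on a fresh qubit, no further interference occurs and the noise
amplitude survives as a factor. -/
theorem amplitude_parityGates {n : ℕ} (p : ℕ) (s : ℕ → Bool) (k : ℕ) (h : p + k < n)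
    (z : Fin n → Bool) : amplitude (parityGates p s k h) z =
      if ∀ j : Fin n, j.val < p ∨ p + k < j.val → z j = false then
        (1 / (Real.sqrt 2 : ℂ)) ^ k *
          noiseAmp (xor (z ⟨p + k, h⟩) (parityBelow s (fun i => extendZero z (p + i)) k))
      else 0 := by
  induction k generalizing z with
  | zero =>
    have h2 : (Real.sqrt 2 : ℂ) ^ 2 = 2 := by
      rw [← Complex.ofReal_pow, Real.sq_sqrt (by norm_num)]; norm_num
    have h2' : (Real.sqrt 2 : ℂ) ≠ 0 := by
      intro h; rw [h] at h2; norm_num at h2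
    set w : Fin n := ⟨p, h⟩ with hw
    have hL : parityGates p s 0 h = [] ++ [.H w] ++ [.T w] ++ [.H w] := rfl
    rw [hL]
    set D : Prop := ∀ j : Fin n, j.val < p ∨ p + 0 < j.val → z j = false with hD
    have hzero : Function.update z w false = (fun _ => false) ↔ D := by
      constructor
      · intro h j hj
        have h1 := congrFun h j
        have h2 : j ≠ w := by rintro rfl; simp [hw] at hj
        simpa [h2] using h1
      · intro h
        funext j
        by_cases hj : j = w
        · simp [hj]
        · rw [Function.update_of_ne hj]
          refine h j ?_
          have : j.val ≠ p := fun h => hj (Fin.ext h)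
          omega
    have hone : Function.update z w true ≠ (fun _ => false) := by
      intro h
      simpa using congrFun h w
    have hH : ∀ b, amplitude ([] ++ [.H w]) (Function.update z w b) =
        if D then 1 / (Real.sqrt 2 : ℂ) else 0 := by
      intro b
      rw [amplitude_H, amplitude_nil, amplitude_nil]
      simp only [Function.update_idem, hzero, hone, if_false, mul_zero, add_zero]
      split_ifs <;> simp
    rw [amplitude_H, amplitude_T, amplitude_T, hH, hH]
    have hpar : parityBelow s (fun i => extendZero z (p + i)) 0 = false := rfl
    have hzw : z ⟨p + 0, h⟩ = z w := rfl
    rw [hpar, hzw]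
    by_cases h3 : D
    · rw [if_pos h3, if_pos h3]
      cases z w <;> simp [noiseAmp] <;> field_simp <;> rw [h2] <;> ring
    · rw [if_neg h3, if_neg h3]
      simp
  | succ k ih =>
    have hk : p + k < n := by omega
    set a : Fin n := ⟨p + k, hk⟩ with ha
    set b : Fin n := ⟨p + (k + 1), h⟩ with hb
    have hab : a ≠ b := by simp [ha, hb]
    rw [parityGates, amplitude_absorbGates _ hab]
    · rw [ih]
      -- The pulled-back string is 0 on wire `b` by construction, so the support condition for `k`
      -- says nothing about `z b` and becomes the one for `k + 1`.
      have hcond : (∀ j : Fin n, j.val < p ∨ p + k < j.val →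
          Function.update (Function.update z a (xor (z b) (s k && z a))) b false j = false) ↔
          ∀ j : Fin n, j.val < p ∨ p + (k + 1) < j.val → z j = false := by
        constructor
        · intro H j hj
          have h1 := H j (by omega)
          have h2 : j ≠ b := by rintro rfl; simp [hb] at hj
          have h3 : j ≠ a := by rintro rfl; simp [ha] at hj
          simpa [h2, h3] using h1
        · intro H j hj
          by_cases h2 : j = b
          · simp [h2]
          · have h3 : j ≠ a := by rintro rfl; simp [ha] at hj
            have h4 : j.val ≠ p + (k + 1) := fun h => h2 (Fin.ext h)
            simpa [h2, h3] using H j (by omega)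
      rw [if_congr hcond rfl rfl]
      split_ifs with h1
      · rw [pow_succ', mul_assoc, parityBelow_succ]
        congr 3
        have h2 : parityBelow s (fun i => extendZero (Function.update (Function.update z a
            (xor (z b) (s k && z a))) b false) (p + i)) k =
            parityBelow s (fun i => extendZero z (p + i)) k := by
          refine parityBelow_congr (fun _ _ => rfl) fun i hi => ?_
          have h3 : p + i < n := by omega
          rw [extendZero_of_lt _ h3, extendZero_of_lt _ h3, Function.update_of_ne,
            Function.update_of_ne]
          · simp [ha]; omega
          · simp [hb]; omega
        rw [h2, extendZero_of_lt _ hk]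
        simp only [Function.update_apply, ← ha, hab, if_false, if_true]
        cases z b <;> cases s k <;> cases z a <;> simp
      · simp
    · intro y hy
      -- Wire `b` lies beyond `p + k`, so by the inductive support condition it has not been touched
      -- yet.
      rw [ih, if_neg]
      intro H
      have := H b (by simp [hb])
      simp [hy] at this

theorem parityGates_length {n : ℕ} (p : ℕ) (s : ℕ → Bool) (k : ℕ) (h : p + k < n) :
    (parityGates p s k h).length ≤ 3 * k + 3 := by
  induction k with
  | zero => simp [parityGates]
  | succ k ih =>
    have := ih (by omega)
    simp only [parityGates, absorbGates, List.length_append]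
    split_ifs <;> simp <;> omega

theorem countP_isT_parityGates {n : ℕ} (p : ℕ) (s : ℕ → Bool) (k : ℕ) (h : p + k < n) :
    (parityGates p s k h).countP Gate.isT = 1 := by
  induction k with
  | zero => rfl
  | succ k ih =>
    have := ih (by omega)
    simp only [parityGates, absorbGates, List.countP_append, this]
    split_ifs <;> simp [Gate.isT]

theorem isLocal_of_mem_parityGates {n : ℕ} (p : ℕ) (s : ℕ → Bool) (k : ℕ) (h : p + k < n)
    {g : Gate n} (hg : g ∈ parityGates p s k h) : g.IsLocal := by
  induction k with
  | zero =>
    simp [parityGates] at hg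
    rcases hg with rfl | rfl | rfl <;> trivial
  | succ k ih =>
    simp only [parityGates, absorbGates, List.mem_append] at hg
    rcases hg with hg | hg | hg
    · exact ih (by omega) hg
    · simp at hg
      rcases hg with rfl | rfl
      · trivial
      · right; simp; omega
    · split_ifs at hg
      · simp at hg
      · simp at hg
        subst hg
        left; simp; omega

/-! ### Layered circuits from gate lists -/

theorem flatten_singletons_append_replicate {α : Type*} (L : List α) (e : ℕ) :
    (L.map (fun g => [g]) ++ List.replicate e []).flatten = L := by
  rw [List.flatten_append, List.flatten_replicate_nil, List.append_nil]
  induction L with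
  | nil => rfl
  | cons a L ih => simpa using ih

/-- Put one gate in each layer and add empty layers until the depth is exactly `d`; disjointness
within layers is then trivial. -/
theorem mem_cliffordOneT_of_gates {n d : ℕ} {P : PMF (Fin n → Bool)} (L : List (Gate n))
    (hlen : L.length ≤ d) (hloc : ∀ g ∈ L, g.IsLocal) (hT : L.countP Gate.isT = 1)
    (hP : ∀ x, (P x).toReal = ‖amplitude L x‖ ^ 2) : P ∈ cliffordOneT n d := by
  have hfl := flatten_singletons_append_replicate L (d - L.length)
  refine ⟨L.map (fun g => [g]) ++ List.replicate (d - L.length) [], ?_, ?_, ?_, ?_⟩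
  · simp; omega
  · intro l hl
    rcases List.mem_append.1 hl with hl | hl
    · obtain ⟨g, hg, rfl⟩ := List.mem_map.1 hl
      exact ⟨by simpa using hloc g hg, by simp⟩
    · rw [List.eq_of_mem_replicate hl]
      exact ⟨by simp, by simp⟩
  · rw [hfl]; exact hT
  · rw [hfl]; exact hP

/-! ### The distribution of padded noisy parities -/

/-- The bit string that consists of `p` zeros, the bits of `x`, and the bit `y`. -/
def padVec (p : ℕ) {k : ℕ} (x : Fin k → Bool) (y : Bool) : Fin (p + (k + 1)) → Bool :=
  Fin.append (fun _ => false) (Fin.snoc x y)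

theorem ofFn_padVec (p : ℕ) {k : ℕ} (x : Fin k → Bool) (y : Bool) :
    List.ofFn (padVec p x y) = List.replicate p false ++ (List.ofFn x ++ [y]) := by
  rw [padVec, List.ofFn_fin_append]
  congr 1
  · simp
  · rw [List.ofFn_succ']; simp

theorem padVec_apply_low (p : ℕ) {k : ℕ} (x : Fin k → Bool) (y : Bool) (j : Fin (p + (k + 1)))
    (h : j.val < p) : padVec p x y j = false := by
  have : j = Fin.castAdd (k + 1) ⟨j, h⟩ := rfl
  rw [this, padVec, Fin.append_left]

theorem padVec_apply_mid (p : ℕ) {k : ℕ} (x : Fin k → Bool) (y : Bool) (i : Fin k)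
    (h : p + i.val < p + (k + 1)) : padVec p x y ⟨p + i, h⟩ = x i := by
  have : (⟨p + i, h⟩ : Fin (p + (k + 1))) = Fin.natAdd p i.castSucc := rfl
  rw [this, padVec, Fin.append_right, Fin.snoc_castSucc]

theorem padVec_apply_last (p : ℕ) {k : ℕ} (x : Fin k → Bool) (y : Bool)
    (h : p + k < p + (k + 1)) : padVec p x y ⟨p + k, h⟩ = y := by
  have : (⟨p + k, h⟩ : Fin (p + (k + 1))) = Fin.natAdd p (Fin.last k) := rfl
  rw [this, padVec, Fin.append_right, Fin.snoc_last]

theorem padVec_injective (p : ℕ) {k : ℕ} {x x' : Fin k → Bool} {y y' : Bool}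
    (h : padVec p x y = padVec p x' y') : x = x' ∧ y = y' := by
  constructor
  · funext i
    rw [← padVec_apply_mid p x y i (by omega), h, padVec_apply_mid]
  · rw [← padVec_apply_last p x y (by omega), h, padVec_apply_last]

theorem exists_eq_padVec {p k : ℕ} {z : Fin (p + (k + 1)) → Bool}
    (hz : ∀ j : Fin (p + (k + 1)), j.val < p → z j = false) :
    ∃ (x : Fin k → Bool) (y : Bool), z = padVec p x y := by
  refine ⟨fun i => z ⟨p + i, by omega⟩, z ⟨p + k, by omega⟩, ?_⟩
  funext j
  rcases lt_or_ge j.val p with h | h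
  · rw [hz j h, padVec_apply_low _ _ _ _ h]
  · rcases lt_or_ge j.val (p + k) with h' | h'
    · have hj : j = ⟨p + (⟨j - p, by omega⟩ : Fin k).val, by simp; omega⟩ := by
        apply Fin.ext; simp; omega
      conv_rhs => rw [hj]
      rw [padVec_apply_mid]
      exact congrArg z hj
    · have hj : j = ⟨p + k, by omega⟩ := by apply Fin.ext; simp; omega
      rw [hj, padVec_apply_last]

/-- Zeros followed by a noisy sample of the parity function `s`. -/
def paddedParity (p : ℕ) {k : ℕ} (s : Fin k → Bool) (η : ℝ) : PMF (Fin (p + (k + 1)) → Bool) :=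
  (PMF.uniformOfFintype (Fin k → Bool)).bind fun x =>
    (biasedBit η).map fun e => padVec p x (xor (parity s x) e)

/-- This lets the LPN oracle stand in for the circuit's sample oracle. -/
theorem samp_paddedParity (p : ℕ) {k : ℕ} (s : Fin k → Bool) (η : ℝ) :
    samp (paddedParity p s η) = (noisyParity s η).map (List.replicate p false ++ ·) := by
  rw [samp, paddedParity, noisyParity, PMF.map_bind, PMF.map_bind]
  congr 1
  funext x
  rw [PMF.map_comp, PMF.map_comp]
  congr 1
  funext e
  exact ofFn_padVec _ _ _

theorem biasedBit_toReal {η : ℝ} (h0 : 0 ≤ η) (h1 : η ≤ 1) (b : Bool) :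
    (biasedBit η b).toReal = if b then η else 1 - η := by
  simp only [biasedBit, PMF.ofFintype_apply, min_eq_right h1, max_eq_right h0]
  cases b <;> simp [h0, h1]

/-- Exactly one choice of the uniform string and the noise bit, namely `x` and `y` ⊕ s·x, produces
the given output. -/
theorem paddedParity_apply_padVec (p : ℕ) {k : ℕ} (s : Fin k → Bool) {η : ℝ} (h0 : 0 ≤ η)
    (h1 : η ≤ 1) (x : Fin k → Bool) (y : Bool) :
    (paddedParity p s η (padVec p x y)).toReal =
      (1 / 2) ^ k * if xor y (parity s x) then η else 1 - η := by
  have hsum : paddedParity p s η (padVec p x y) =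
      (2 ^ k : ENNReal)⁻¹ * biasedBit η (xor y (parity s x)) := by
    rw [paddedParity, PMF.bind_apply, tsum_eq_single x]
    · rw [PMF.uniformOfFintype_apply, PMF.map_apply, tsum_eq_single (xor y (parity s x))]
      · rw [if_pos]
        · simp
        · congr 1; cases y <;> simp
      · intro e he
        rw [if_neg]
        intro h
        apply he
        rw [(padVec_injective p h).2]
        cases parity s x <;> simp
    · intro x' hx'
      rw [PMF.map_apply, ENNReal.tsum_eq_zero.2, mul_zero]
      intro e
      rw [if_neg]
      intro h
      exact hx' (padVec_injective p h).1.symm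
  rw [hsum, ENNReal.toReal_mul, biasedBit_toReal h0 h1]
  simp

theorem paddedParity_apply_of_ne (p : ℕ) {k : ℕ} (s : Fin k → Bool) (η : ℝ)
    {z : Fin (p + (k + 1)) → Bool} (hz : ∀ x y, z ≠ padVec p x y) : paddedParity p s η z = 0 := by
  rw [paddedParity, PMF.bind_apply, ENNReal.tsum_eq_zero.2]
  intro x
  rw [PMF.map_apply, ENNReal.tsum_eq_zero.2, mul_zero]
  intro e
  rw [if_neg (hz _ _)]

theorem noiseRate_pos : 0 < noiseRate := by
  have : Real.sqrt 2 < 2 := by rw [Real.sqrt_lt' (by norm_num)]; norm_num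
  unfold noiseRate; linarith

/-- The two values η and 1 - η are thus at distance at least 7/20 from the threshold 1/2, which
leaves room for the errors 1/5 of `Q` and 1/16 of the evaluator. -/
theorem noiseRate_le : noiseRate ≤ 3 / 20 := by
  have : (7 / 5 : ℝ) ≤ Real.sqrt 2 := Real.le_sqrt_of_sq_le (by norm_num)
  unfold noiseRate; linarith

theorem paddedParity_mem_cliffordOneT (p : ℕ) {k : ℕ} (s : Fin k → Bool) {d : ℕ}
    (hd : 3 * k + 3 ≤ d) : paddedParity p s noiseRate ∈ cliffordOneT (p + (k + 1)) d := by
  have hk : p + k < p + (k + 1) := by omega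
  have hη := noiseRate_pos
  have hη' := noiseRate_le
  refine mem_cliffordOneT_of_gates (parityGates p (extendZero s) k hk)
    ((parityGates_length _ _ _ _).trans hd) (fun g => isLocal_of_mem_parityGates _ _ _ _)
    (countP_isT_parityGates _ _ _ _) fun z => ?_
  rw [amplitude_parityGates]
  -- With n = p + k + 1 there are no wires beyond `p + k`, so only the first `p` wires restrict the
  -- support.
  by_cases hz : ∀ j : Fin (p + (k + 1)), j.val < p → z j = false
  · obtain ⟨x, y, rfl⟩ := exists_eq_padVec hz
    rw [paddedParity_apply_padVec p s hη.le (by linarith), if_pos (c := ∀ j, _), norm_mul, mul_pow,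
      normSq_noiseAmp, padVec_apply_last, parity_eq_parityBelow]
    · have h2 : (‖(1 / (Real.sqrt 2 : ℂ)) ^ k‖) ^ 2 = (1 / 2 : ℝ) ^ k := by
        rw [norm_pow, ← pow_mul, mul_comm, pow_mul]
        congr 1
        rw [norm_div, norm_one, Complex.norm_real, Real.norm_eq_abs, div_pow, sq_abs,
          Real.sq_sqrt (by norm_num)]
        norm_num
      have h3 : parityBelow (extendZero s) (extendZero x) k =
          parityBelow (extendZero s) (fun i => extendZero (padVec p x y) (p + i)) k := by
        refine parityBelow_congr (fun _ _ => rfl) fun i hi => ?_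
        rw [extendZero_of_lt _ hi, extendZero_of_lt _ (by omega)]
        exact (padVec_apply_mid p x y ⟨i, hi⟩ _).symm
      rw [h2, h3]
    · rintro j (hj | hj)
      · exact hz j hj
      · omega
  · rw [paddedParity_apply_of_ne, if_neg]
    · simp
    · exact fun H => hz fun j hj => H j (Or.inl hj)
    · rintro x y rfl
      exact hz fun j hj => padVec_apply_low _ _ _ _ hj


/-! ### Lengths of register contents -/

/-- A step adds at most one bit to a register or replaces its content by an oracle answer. The
resulting bound on the learner's output is needed because the description is copied before each
evaluation. -/
theorem length_le_of_mem_support_step {O : PMF (List Bool)} {ℓ : ℕ}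
    (hO : ∀ l ∈ O.support, l.length ≤ ℓ) {c c' : Config} (hc : ∀ r, (c.2.reg r).length ≤ ℓ)
    (hc' : c' ∈ (step O c).support) (r : ℕ) : (c'.2.reg r).length ≤ ℓ + 1 := by
  have hc1 : ∀ r, (c.2.reg r).length ≤ ℓ + 1 := fun r => (hc r).trans (Nat.le_succ _)
  have hset : ∀ (m : Mem) (r r' : ℕ) (l : List Bool), (∀ r, (m.reg r).length ≤ ℓ + 1) →
      l.length ≤ ℓ + 1 → ((m.set r' l).reg r).length ≤ ℓ + 1 := by
    intro m r r' l h1 h2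
    rw [Mem.set_reg]
    split_ifs
    · exact h2
    · exact h1 r
  obtain ⟨_ | ⟨p, K⟩, m⟩ := c
  · simp [step] at hc'
    subst hc'
    exact hc1 r
  · cases p with
    | push r' b =>
      simp [step] at hc'
      subst hc'
      exact hset _ _ _ _ hc1 (by simpa using hc r')
    | pop r' =>
      simp [step] at hc'
      subst hc'
      refine hset _ _ _ _ hc1 ?_
      have := hc r'
      simp only [List.length_tail]
      dsimp only at this
      omega
    | clear r' =>
      simp [step] at hc'
      subst hc'
      exact hset _ _ _ _ hc1 (by simp)
    | seq p q =>
      simp [step] at hc'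
      subst hc'
      exact hc1 r
    | cond r' e p q =>
      rcases h : m.reg r' with _ | ⟨_ | _, l⟩ <;> simp [step, h] at hc' <;> subst hc' <;>
        exact hc1 r
    | loop r' p =>
      rcases h : m.reg r' with _ | ⟨b, l⟩ <;> simp [step, h] at hc' <;> subst hc' <;>
        exact hc1 r
    | coin r' =>
      simp only [step, PMF.support_map, Set.mem_image] at hc'
      obtain ⟨b, _, rfl⟩ := hc'
      exact hset _ _ _ _ hc1 (by simpa using hc r')
    | sample r' =>
      simp only [step, PMF.support_map, Set.mem_image] at hc'
      obtain ⟨l, hl, rfl⟩ := hc'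
      exact hset _ _ _ _ hc1 ((hO l hl).trans (Nat.le_succ _))
    | qreset | had | tgate | cnot =>
      simp [step] at hc'
      subst hc'
      exact hc1 r
    | meas r' r'' =>
      simp only [step, PMF.support_map, Set.mem_image] at hc'
      obtain ⟨b, _, rfl⟩ := hc'
      exact hset m r r'' _ hc1 (by simpa using hc r'')

theorem length_le_of_mem_support_runFor {O : PMF (List Bool)} {ℓ : ℕ}
    (hO : ∀ l ∈ O.support, l.length ≤ ℓ) (t : ℕ) {c c' : Config}
    (hc : ∀ r, (c.2.reg r).length ≤ ℓ) (hc' : c' ∈ (runFor O t c).support) (r : ℕ) :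
    (c'.2.reg r).length ≤ ℓ + t := by
  induction t generalizing ℓ c with
  | zero =>
    simp [runFor] at hc'
    subst hc'
    exact hc r
  | succ t ih =>
    rw [runFor, PMF.mem_support_bind_iff] at hc'
    obtain ⟨c₁, h1, h2⟩ := hc'
    have := ih (ℓ := ℓ + 1) (fun l hl => (hO l hl).trans (Nat.le_succ _))
      (fun r => length_le_of_mem_support_step hO hc h1 r) h2
    omega

/-- The length bound holds on the whole support of the run, so it can be added to the success event
without loss. -/
theorem successProb_le_of_length {O : PMF (List Bool)} {ℓ : ℕ}
    (hO : ∀ l ∈ O.support, l.length ≤ ℓ) (t : ℕ) {A : Prog} {inputs : List (List Bool)}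
    (hin : ∀ l ∈ inputs, l.length ≤ ℓ) (good : List Bool → Prop) :
    successProb O A inputs t good ≤ (runFor O t ([A], initMem inputs)).toOuterMeasure
      {c | c.1 = [] ∧ (good (c.2.reg 0) ∧ (c.2.reg 0).length ≤ ℓ + t)} := by
  refine PMF.toOuterMeasure_mono _ ?_
  rintro c ⟨⟨h1, h2⟩, h3⟩
  refine ⟨h1, h2, length_le_of_mem_support_runFor hO t (fun r => ?_) h3 0⟩
  simp only [initMem]
  by_cases hr : r < inputs.length
  · rw [List.getD_eq_getElem _ _ hr]
    exact hin _ (List.getElem_mem hr)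
  · rw [List.getD_eq_default _ _ (by omega)]
    simp

/-! ### Register operations in a partitioned memory -/

section pieces

variable {B : ℕ} {a : ℕ → List Bool} {q : QState} {ls : List (List Bool)}

theorem exec_push_high {i : ℕ} (b : Bool) (hi : i < ls.length) :
    Exec (.push (B + i) b) (memOf B a q ls) 1 (memOf B a q (ls.set i (b :: ls.getD i []))) := by
  have := exec_push (B + i) b (memOf B a q ls)
  rwa [memOf_set_high hi, memOf_reg_high] at this

theorem exec_pop_high {i : ℕ} (hi : i < ls.length) :
    Exec (.pop (B + i)) (memOf B a q ls) 1 (memOf B a q (ls.set i (ls.getD i []).tail)) := by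
  have := exec_pop (B + i) (memOf B a q ls)
  rwa [memOf_set_high hi, memOf_reg_high] at this

theorem exec_clear_high {i : ℕ} (hi : i < ls.length) :
    Exec (.clear (B + i)) (memOf B a q ls) 1 (memOf B a q (ls.set i [])) := by
  have := exec_clear (B + i) (memOf B a q ls)
  rwa [memOf_set_high hi] at this

theorem exec_push_low {r : ℕ} (b : Bool) (hr : r < B) :
    Exec (.push r b) (memOf B a q ls) 1 (memOf B (Function.update a r (b :: a r)) q ls) := by
  have := exec_push r b (memOf B a q ls)
  rwa [memOf_set_low hr, memOf_reg_low hr] at this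

theorem exec_pop_low {r : ℕ} (hr : r < B) :
    Exec (.pop r) (memOf B a q ls) 1 (memOf B (Function.update a r (a r).tail) q ls) := by
  have := exec_pop r (memOf B a q ls)
  rwa [memOf_set_low hr, memOf_reg_low hr] at this

theorem exec_clear_low {r : ℕ} (hr : r < B) :
    Exec (.clear r) (memOf B a q ls) 1 (memOf B (Function.update a r []) q ls) := by
  have := exec_clear r (memOf B a q ls)
  rwa [memOf_set_low hr] at this

theorem exec_prepend_high {i j : ℕ} (hij : i ≠ j) (hi0 : i ≠ 0) (hj0 : j ≠ 0) (hj : j < ls.length)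
    (h0 : ls.getD 0 [] = []) : Exec (prepend (B + i) (B + j) (B + 0)) (memOf B a q ls)
      (12 * (ls.getD i []).length + 3) (memOf B a q (ls.set j (ls.getD i [] ++ ls.getD j []))) := by
  have := exec_prepend (s := B + i) (d := B + j) (t := B + 0) (by omega) (by omega) (by omega)
    (memOf B a q ls) (by rw [memOf_reg_high, h0])
  rwa [memOf_set_high hj, memOf_reg_high, memOf_reg_high] at this

theorem exec_prepend_low_high {r j : ℕ} (hr : r < B) (hj0 : j ≠ 0) (hj : j < ls.length)
    (h0 : ls.getD 0 [] = []) : Exec (prepend r (B + j) (B + 0)) (memOf B a q ls)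
      (12 * (a r).length + 3) (memOf B a q (ls.set j (a r ++ ls.getD j []))) := by
  have := exec_prepend (s := r) (d := B + j) (t := B + 0) (by omega) (by omega) (by omega)
    (memOf B a q ls) (by rw [memOf_reg_high, h0])
  rwa [memOf_set_high hj, memOf_reg_high, memOf_reg_low hr] at this

theorem exec_prepend_high_low {i r : ℕ} (hr : r < B) (hi0 : i ≠ 0)
    (h0 : ls.getD 0 [] = []) : Exec (prepend (B + i) r (B + 0)) (memOf B a q ls)
      (12 * (ls.getD i []).length + 3)
      (memOf B (Function.update a r (ls.getD i [] ++ a r)) q ls) := by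
  have := exec_prepend (s := B + i) (d := r) (t := B + 0) (by omega) (by omega) (by omega)
    (memOf B a q ls) (by rw [memOf_reg_high, h0])
  rwa [memOf_set_low hr, memOf_reg_high, memOf_reg_low hr] at this

theorem exec_prependReverse_high_low {i r : ℕ} (hr : r < B) (hi0 : i ≠ 0)
    (h0 : ls.getD 0 [] = []) : Exec (prependReverse (B + i) r (B + 0)) (memOf B a q ls)
      (12 * (ls.getD i []).length + 3)
      (memOf B (Function.update a r ((ls.getD i []).reverse ++ a r)) q ls) := by
  have := exec_prependReverse (s := B + i) (d := r) (t := B + 0) (by omega) (by omega) (by omega)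
    (memOf B a q ls) (by rw [memOf_reg_high, h0])
  rwa [memOf_set_low hr, memOf_reg_high, memOf_reg_low hr] at this

/-- Empty the registers below `n`. -/
def clearBelow : ℕ → Prog
  | 0 => .clear 0
  | n + 1 => .seq (.clear n) (clearBelow n)

/-- The disjunct `r = 0` accounts for the base case, which clears register 0 for want of an empty
program. -/
theorem exec_clearBelow_aux (n : ℕ) (hB : 0 < B) (hn : n ≤ B) :
    Exec (clearBelow n) (memOf B a q ls) (2 * n + 1)
      (memOf B (fun r => if r < n ∨ r = 0 then [] else a r) q ls) := by
  induction n generalizing a with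
  | zero =>
    have h := exec_clear_low (a := a) (q := q) (ls := ls) hB
    rw [clearBelow]
    convert h using 2
    funext r
    simp [Function.update_apply]
  | succ n ih =>
    have h1 := exec_clear_low (a := a) (q := q) (ls := ls) (show n < B by omega)
    have h2 := ih (a := Function.update a n []) (by omega)
    have h3 := (h1.seq h2).mono (t' := 2 * (n + 1) + 1) (by omega)
    rw [clearBelow]
    convert h3 using 2
    funext r
    by_cases hr : r = n
    · simp [hr]
    · have : r < n + 1 ↔ r < n := by omega
      simp [hr, this]

theorem exec_clearBelow (hB : 0 < B) :
    Exec (clearBelow B) (memOf B a q ls) (2 * B + 1) (memOf B (fun _ => []) q ls) := by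
  have h := exec_clearBelow_aux (a := a) (q := q) (ls := ls) B hB le_rfl
  have e : memOf B (fun r => if r < B ∨ r = 0 then [] else a r) q ls = memOf B (fun _ => []) q ls :=
    memOf_congr fun r hr => by simp [hr]
  rwa [e] at h

theorem unary_append (m n : ℕ) : unary m ++ unary n = unary (m + n) :=
  List.replicate_append_replicate

theorem length_unary (m : ℕ) : (unary m).length = m := List.length_replicate

/-! ### Unary arithmetic -/

/-- Multiply the unary numbers in the registers `2` and `5` and store the result in register `2`;
register `8` is used as an accumulator. -/
def mulProg (B : ℕ) : Prog :=
  .seq (.loop (B + 2) (.seq (.pop (B + 2)) (prepend (B + 5) (B + 8) (B + 0))))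
    (.seq (prepend (B + 8) (B + 2) (B + 0)) (.clear (B + 8)))

theorem exec_mulProg {l1 l3 l4 l6 l7 : List Bool} (b n : ℕ) (hb : 1 ≤ b) (hn : 1 ≤ n) :
    Exec (mulProg B) (memOf B a q [[], l1, unary n, l3, l4, unary b, l6, l7, []]) (50 * (b * n))
      (memOf B a q [[], l1, unary (b * n), l3, l4, unary b, l6, l7, []]) := by
  have h1 : Exec (.loop (B + 2) (.seq (.pop (B + 2)) (prepend (B + 5) (B + 8) (B + 0))))
      (memOf B a q [[], l1, unary n, l3, l4, unary b, l6, l7, unary (b * (n - n))])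
      (n * ((12 * b + 5) + 1) + 1)
      (memOf B a q [[], l1, unary 0, l3, l4, unary b, l6, l7, unary (b * (n - 0))]) := by
    -- Loop invariant: with `i` rounds left, the accumulator holds `b * (n - i)`.
    refine Exec.loop_iterate (fun i =>
      memOf B a q [[], l1, unary i, l3, l4, unary b, l6, l7, unary (b * (n - i))]) n ?_ ?_ ?_
    · rw [memOf_reg_high]; rfl
    · intro i _
      rw [memOf_reg_high]
      simp [unary]
    · intro i hi
      have e1 : Exec (.pop (B + 2))
          (memOf B a q [[], l1, unary (i + 1), l3, l4, unary b, l6, l7, unary (b * (n - (i + 1)))])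
          1 (memOf B a q [[], l1, unary i, l3, l4, unary b, l6, l7, unary (b * (n - (i + 1)))]) :=
        exec_pop_high (i := 2) (by simp)
      have e2 : Exec (prepend (B + 5) (B + 8) (B + 0))
          (memOf B a q [[], l1, unary i, l3, l4, unary b, l6, l7, unary (b * (n - (i + 1)))])
          (12 * (unary b).length + 3) (memOf B a q
            [[], l1, unary i, l3, l4, unary b, l6, l7, unary b ++ unary (b * (n - (i + 1)))]) :=
        exec_prepend_high (i := 5) (j := 8) (by omega) (by omega) (by omega) (by simp) rfl
      have e3 := e1.seq e2
      rw [unary_append, length_unary] at e3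
      have e4 : b + b * (n - (i + 1)) = b * (n - i) := by
        have : n - i = (n - (i + 1)) + 1 := by omega
        rw [this]; ring
      rw [e4] at e3
      exact e3.mono (by omega)
  have h2 : Exec (prepend (B + 8) (B + 2) (B + 0))
      (memOf B a q [[], l1, unary 0, l3, l4, unary b, l6, l7, unary (b * n)])
      (12 * (unary (b * n)).length + 3)
      (memOf B a q [[], l1, unary (b * n) ++ unary 0, l3, l4, unary b, l6, l7, unary (b * n)]) :=
    exec_prepend_high (i := 8) (j := 2) (by omega) (by omega) (by omega) (by simp) rfl
  have h3 : Exec (.clear (B + 8))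
      (memOf B a q [[], l1, unary (b * n) ++ unary 0, l3, l4, unary b, l6, l7, unary (b * n)]) 1
      (memOf B a q [[], l1, unary (b * n) ++ unary 0, l3, l4, unary b, l6, l7, []]) :=
    exec_clear_high (i := 8) (by simp)
  rw [Nat.sub_self, Nat.sub_zero, mul_zero] at h1
  have h4 := h1.seq (h2.seq h3)
  rw [unary_append, length_unary, add_zero] at h4
  refine h4.mono ?_
  have h5 : n ≤ b * n := Nat.le_mul_of_pos_left _ hb
  have h6 : n * (12 * b + 5 + 1) = 12 * (b * n) + 6 * n := by ring
  omega

/-- Raise the unary number in register `5` to the power `j` and store the result in the empty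
register `2`. -/
def powProg (B : ℕ) : ℕ → Prog
  | 0 => .push (B + 2) true
  | j + 1 => .seq (powProg B j) (mulProg B)

theorem exec_powProg {l1 l3 l4 l6 l7 : List Bool} (b : ℕ) (hb : 1 ≤ b) (j : ℕ) :
    Exec (powProg B j) (memOf B a q [[], l1, [], l3, l4, unary b, l6, l7, []])
      (51 * (j + 1) * b ^ j) (memOf B a q [[], l1, unary (b ^ j), l3, l4, unary b, l6, l7, []]) := by
  induction j with
  | zero =>
    have h : Exec (.push (B + 2) true) (memOf B a q [[], l1, [], l3, l4, unary b, l6, l7, []]) 1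
      (memOf B a q [[], l1, [true], l3, l4, unary b, l6, l7, []]) :=
      exec_push_high (i := 2) true (by simp)
    exact h.mono (by simp)
  | succ j ih =>
    have hpos : 1 ≤ b ^ j := Nat.one_le_pow _ _ hb
    have h := ih.seq (exec_mulProg b (b ^ j) hb hpos)
    rw [← pow_succ'] at h
    refine h.mono ?_
    -- The last multiplication together with the composition costs at most 51 b^(j+1), and the
    -- earlier ones are estimated by the same power.
    have h1 : b ^ j ≤ b ^ (j + 1) := Nat.pow_le_pow_right hb (by omega)
    have h2 : 51 * (j + 1) * b ^ j ≤ 51 * (j + 1) * b ^ (j + 1) := Nat.mul_le_mul_left _ h1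
    have h3 : 51 * (j + 1 + 1) * b ^ (j + 1) = 51 * (j + 1) * b ^ (j + 1) + 51 * b ^ (j + 1) := by
      ring
    omega

/-- Push `c` ones onto register `5`. -/
def pushOnes (B : ℕ) : ℕ → Prog
  | 0 => .clear (B + 0)
  | c + 1 => .seq (.push (B + 5) true) (pushOnes B c)

theorem exec_pushOnes {l1 l2 l3 l4 l6 l7 l8 : List Bool} (c b : ℕ) :
    Exec (pushOnes B c) (memOf B a q [[], l1, l2, l3, l4, unary b, l6, l7, l8]) (2 * c + 1)
      (memOf B a q [[], l1, l2, l3, l4, unary (b + c), l6, l7, l8]) := by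
  induction c generalizing b with
  | zero => exact exec_clear_high (i := 0) (by simp)
  | succ c ih =>
    have h : Exec (.push (B + 5) true) (memOf B a q [[], l1, l2, l3, l4, unary b, l6, l7, l8]) 1
      (memOf B a q [[], l1, l2, l3, l4, unary (b + 1), l6, l7, l8]) :=
      exec_push_high (i := 5) true (by simp)
    have h2 := h.seq (ih (b + 1))
    rw [add_assoc b 1 c, add_comm 1 c] at h2
    exact h2.mono (by omega)

/-- Fill register `3` with as many zeros as the difference of the unary numbers in the registers `2`
and `1`. -/
def zerosProg (B : ℕ) : Prog :=
  .seq (prepend (B + 2) (B + 8) (B + 0)) <|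
  .seq (.loop (B + 8) (.seq (.pop (B + 8)) (.push (B + 3) false))) <|
  .seq (prepend (B + 1) (B + 8) (B + 0))
  (.loop (B + 8) (.seq (.pop (B + 8)) (.pop (B + 3))))

/-- Pushing `n` zeros and popping `m` of them computes the truncated difference, since popping an
empty register has no effect. -/
theorem exec_zerosProg {l4 l5 l6 l7 : List Bool} (m n : ℕ) :
    Exec (zerosProg B) (memOf B a q [[], unary m, unary n, [], l4, l5, l6, l7, []])
      (16 * m + 16 * n + 12)
      (memOf B a q [[], unary m, unary n, List.replicate (n - m) false, l4, l5, l6, l7, []]) := by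
  have h1 : Exec (prepend (B + 2) (B + 8) (B + 0))
      (memOf B a q [[], unary m, unary n, [], l4, l5, l6, l7, []]) (12 * (unary n).length + 3)
      (memOf B a q [[], unary m, unary n, [], l4, l5, l6, l7, unary n ++ []]) :=
    exec_prepend_high (i := 2) (j := 8) (by omega) (by omega) (by omega) (by simp) rfl
  have h2 : Exec (.loop (B + 8) (.seq (.pop (B + 8)) (.push (B + 3) false)))
      (memOf B a q
        [[], unary m, unary n, List.replicate (n - n) false, l4, l5, l6, l7, unary n])
      (n * (3 + 1) + 1)
      (memOf B a q
        [[], unary m, unary n, List.replicate (n - 0) false, l4, l5, l6, l7, unary 0]) := by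
    refine Exec.loop_iterate (fun i => memOf B a q
      [[], unary m, unary n, List.replicate (n - i) false, l4, l5, l6, l7, unary i]) n ?_ ?_ ?_
    · rw [memOf_reg_high]; rfl
    · intro i _
      rw [memOf_reg_high]
      simp [unary]
    · intro i hi
      have e1 : Exec (.pop (B + 8))
          (memOf B a q [[], unary m, unary n, List.replicate (n - (i + 1)) false, l4, l5, l6, l7,
            unary (i + 1)]) 1
          (memOf B a q [[], unary m, unary n, List.replicate (n - (i + 1)) false, l4, l5, l6, l7,
            unary i]) := exec_pop_high (i := 8) (by simp)
      have e2 : Exec (.push (B + 3) false)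
          (memOf B a q [[], unary m, unary n, List.replicate (n - (i + 1)) false, l4, l5, l6, l7,
            unary i]) 1
          (memOf B a q [[], unary m, unary n, false :: List.replicate (n - (i + 1)) false, l4, l5,
            l6, l7, unary i]) := exec_push_high (i := 3) false (by simp)
      have e3 := e1.seq e2
      rw [← List.replicate_succ, show n - (i + 1) + 1 = n - i by omega] at e3
      exact e3
  have h3 : Exec (prepend (B + 1) (B + 8) (B + 0))
      (memOf B a q [[], unary m, unary n, List.replicate n false, l4, l5, l6, l7, []])
      (12 * (unary m).length + 3)
      (memOf B a q [[], unary m, unary n, List.replicate n false, l4, l5, l6, l7, unary m ++ []]) :=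
    exec_prepend_high (i := 1) (j := 8) (by omega) (by omega) (by omega) (by simp) rfl
  have h4 : Exec (.loop (B + 8) (.seq (.pop (B + 8)) (.pop (B + 3))))
      (memOf B a q [[], unary m, unary n, List.replicate (n - (m - m)) false, l4, l5, l6, l7,
        unary m]) (m * (3 + 1) + 1)
      (memOf B a q [[], unary m, unary n, List.replicate (n - (m - 0)) false, l4, l5, l6, l7,
        unary 0]) := by
    refine Exec.loop_iterate (fun i => memOf B a q [[], unary m, unary n,
      List.replicate (n - (m - i)) false, l4, l5, l6, l7, unary i]) m ?_ ?_ ?_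
    · rw [memOf_reg_high]; rfl
    · intro i _
      rw [memOf_reg_high]
      simp [unary]
    · intro i hi
      have e1 : Exec (.pop (B + 8))
          (memOf B a q [[], unary m, unary n, List.replicate (n - (m - (i + 1))) false, l4, l5, l6,
            l7, unary (i + 1)]) 1
          (memOf B a q [[], unary m, unary n, List.replicate (n - (m - (i + 1))) false, l4, l5, l6,
            l7, unary i]) := exec_pop_high (i := 8) (by simp)
      have e2 : Exec (.pop (B + 3))
          (memOf B a q [[], unary m, unary n, List.replicate (n - (m - (i + 1))) false, l4, l5, l6,
            l7, unary i]) 1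
          (memOf B a q [[], unary m, unary n, (List.replicate (n - (m - (i + 1))) false).tail, l4,
            l5, l6, l7, unary i]) := exec_pop_high (i := 3) (by simp)
      have e3 := e1.seq e2
      rw [List.tail_replicate, show n - (m - (i + 1)) - 1 = n - (m - i) by omega] at e3
      exact e3
  rw [List.append_nil] at h1 h3
  simp only [Nat.sub_self, Nat.sub_zero, List.replicate_zero] at h2 h4
  rw [length_unary] at h1 h3
  exact (h1.seq (h2.seq (h3.seq h4))).mono (by omega)

/-! ### Preparing the inputs of the learner -/

theorem initMem_reg_three (x y z : List Bool) : (initMem [x, y, z]).reg =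
    Function.update (Function.update (Function.update (fun _ => []) 0 x) 1 y) 2 z := by
  funext r
  rcases r with _ | _ | _ | r <;> simp [initMem]

/-- From `k` and `D` in unary, compute `k + 1`, `N = (k + D + c) ^ j` and `N - (k + 1)` zeros, and
put `N` into the registers `0`, `1`, `2`. -/
def setupProg (B c j : ℕ) : Prog :=
  .seq (prepend 0 (B + 1) (B + 0)) <|
  .seq (.push (B + 1) true) <|
  .seq (prepend 0 (B + 5) (B + 0)) <|
  .seq (prepend 1 (B + 5) (B + 0)) <|
  .seq (pushOnes B c) <|
  .seq (powProg B j) <|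
  .seq (.clear (B + 5)) <|
  .seq (zerosProg B) <|
  .seq (clearBelow B) <|
  .seq (prepend (B + 2) 0 (B + 0)) <|
  .seq (prepend (B + 2) 1 (B + 0)) (prepend (B + 2) 2 (B + 0))

/-- This fixes the layout from `B` on: 0 is scratch space for copying, 1 holds k + 1, 2 holds N, 3
the padding zeros. Later 4 holds the description of the evaluator, 5 the bits of the point already
flipped (in reverse), 6 the bits still to be flipped, 7 the parities found, and 8 is a loop counter.
The hypothesis `hkN` makes every linear cost a multiple of N. -/
theorem exec_setupProg (hB : 3 ≤ B) {k D c j N : ℕ} (ha0 : a 0 = unary k) (ha1 : a 1 = unary D)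
    (hpos : 1 ≤ k + D + c) (hN : (k + D + c) ^ j = N) (hkN : k + D + c ≤ N) :
    Exec (setupProg B c j) (memOf B a q (List.replicate 9 [])) ((51 * j + 2 * B + 300) * N)
      (memOf B (initMem [unary N, unary N, unary N]).reg q
        [[], unary (k + 1), unary N, List.replicate (N - (k + 1)) false, [], [], [], [], []]) := by
  have h1 : Exec (prepend 0 (B + 1) (B + 0)) (memOf B a q (List.replicate 9 []))
      (12 * (a 0).length + 3) (memOf B a q [[], a 0 ++ [], [], [], [], [], [], [], []]) :=
    exec_prepend_low_high (j := 1) (by omega) (by omega) (by simp) rfl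
  rw [List.append_nil, ha0, length_unary] at h1
  have h2 : Exec (.push (B + 1) true) (memOf B a q [[], unary k, [], [], [], [], [], [], []]) 1
      (memOf B a q [[], unary (k + 1), [], [], [], [], [], [], []]) :=
    exec_push_high (i := 1) true (by simp)
  have h3 : Exec (prepend 0 (B + 5) (B + 0))
      (memOf B a q [[], unary (k + 1), [], [], [], [], [], [], []]) (12 * (a 0).length + 3)
      (memOf B a q [[], unary (k + 1), [], [], [], a 0 ++ [], [], [], []]) :=
    exec_prepend_low_high (j := 5) (by omega) (by omega) (by simp) rfl
  rw [List.append_nil, ha0, length_unary] at h3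
  have h4 : Exec (prepend 1 (B + 5) (B + 0))
      (memOf B a q [[], unary (k + 1), [], [], [], unary k, [], [], []]) (12 * (a 1).length + 3)
      (memOf B a q [[], unary (k + 1), [], [], [], a 1 ++ unary k, [], [], []]) :=
    exec_prepend_low_high (j := 5) (by omega) (by omega) (by simp) rfl
  rw [ha1, unary_append, length_unary, add_comm D k] at h4
  have h5 := exec_pushOnes (B := B) (a := a) (q := q) (l1 := unary (k + 1)) (l2 := []) (l3 := [])
    (l4 := []) (l6 := []) (l7 := []) (l8 := []) c (k + D)
  have h6 := exec_powProg (B := B) (a := a) (q := q) (l1 := unary (k + 1)) (l3 := [])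
    (l4 := []) (l6 := []) (l7 := []) (k + D + c) hpos j
  rw [hN] at h6
  have h7 : Exec (.clear (B + 5))
      (memOf B a q [[], unary (k + 1), unary N, [], [], unary (k + D + c), [], [], []]) 1
      (memOf B a q [[], unary (k + 1), unary N, [], [], [], [], [], []]) :=
    exec_clear_high (i := 5) (by simp)
  have h8 := exec_zerosProg (B := B) (a := a) (q := q) (l4 := []) (l5 := []) (l6 := []) (l7 := [])
    (k + 1) N
  set Z := List.replicate (N - (k + 1)) false
  have h9 := exec_clearBelow (B := B) (a := a) (q := q)
    (ls := [[], unary (k + 1), unary N, Z, [], [], [], [], []]) (by omega)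
  have h10 : ∀ (a : ℕ → List Bool) (r : ℕ), r < B → a r = [] →
      Exec (prepend (B + 2) r (B + 0))
        (memOf B a q [[], unary (k + 1), unary N, Z, [], [], [], [], []]) (12 * N + 3)
        (memOf B (Function.update a r (unary N)) q
          [[], unary (k + 1), unary N, Z, [], [], [], [], []]) := by
    intro a r hr har
    have : Exec (prepend (B + 2) r (B + 0))
        (memOf B a q [[], unary (k + 1), unary N, Z, [], [], [], [], []])
        (12 * (unary N).length + 3)
        (memOf B (Function.update a r (unary N ++ a r)) q
          [[], unary (k + 1), unary N, Z, [], [], [], [], []]) :=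
      exec_prepend_high_low (i := 2) hr (by omega) rfl
    rwa [har, List.append_nil, length_unary] at this
  rw [initMem_reg_three]
  refine (h1.seq (h2.seq (h3.seq (h4.seq (h5.seq (h6.seq (h7.seq (h8.seq (h9.seq
    ((h10 _ 0 (by omega) rfl).seq ((h10 _ 1 (by omega) (by simp)).seq
      (h10 _ 2 (by omega) (by simp))))))))))))).mono ?_
  have e1 : 51 * (j + 1) * N = 51 * j * N + 51 * N := by ring
  have e2 : (51 * j + 2 * B + 300) * N = 51 * j * N + 2 * (B * N) + 300 * N := by ring
  have e3 : B ≤ B * N := Nat.le_mul_of_pos_right _ (by omega)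
  omega

end pieces

theorem hit_seq {O : PMF (List Bool)} {f : Config → ENNReal} (p q : Prog) (K : List Prog) (m : Mem)
    (t : ℕ) : hit O f t (p :: q :: K, m) ≤ hit O f (t + 1) (.seq p q :: K, m) :=
  hit_of_step_pure rfl t

theorem Exec.hit_le_seq {O : PMF (List Bool)} {f : Config → ENNReal} {p : Prog} {m m' : Mem} {t : ℕ}
    (h : Exec p m t m') (q : Prog) (K : List Prog) (t' : ℕ) :
    hit O f t' (q :: K, m') ≤ hit O f (t + t' + 1) (.seq p q :: K, m) :=
  (h.hit_le (q :: K) t').trans (hit_seq _ _ _ _ _)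

/-! ### The quantum memory -/

/-- What is known about the quantum memory after an algorithm of kind `M` has been executed: classical
algorithms do not touch it. -/
def Model.Leaves (M : Model) (q : QState) : Prop := M = .classical → q = QState.zero

theorem Model.Allows.isClassical_or {M : Model} {p : Prog} (h : M.Allows p) :
    p.IsClassical ∨ ∀ q, M.Leaves q := by
  cases M
  · exact Or.inl h
  · right
    intro q h
    cases h

theorem Model.leaves_zero (M : Model) : M.Leaves QState.zero := fun _ => rfl

/-- Reset the quantum memory by means of an algorithm of kind `M`. -/
def Model.resetProg (B : ℕ) : Model → Prog
  | .classical => .pop (B + 0)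
  | .quantum => .qreset

section pieces

variable {B : ℕ} {M : Model} {a : ℕ → List Bool} {q : QState} {ls : List (List Bool)}

/-- A classical program may not reset the quantum memory but need not either, as it is still zero;
popping the empty scratch register is a no-op that also takes one step. -/
theorem exec_resetProg (hq : M.Leaves q) (hls : 0 < ls.length) (h0 : ls.getD 0 [] = []) :
    Exec (M.resetProg B) (memOf B a q ls) 1 (memOf B a QState.zero ls) := by
  cases M
  · have h := exec_pop_high (B := B) (a := a) (q := q) hls
    rw [hq rfl] at h ⊢
    have h2 : ls.set 0 (ls.getD 0 []).tail = ls := by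
      obtain ⟨l, ls, rfl⟩ := List.exists_cons_of_length_pos hls
      simp at h0
      simp [h0]
    rwa [h2] at h
  · exact .of_step fun _ _ => rfl

/-! ### Evaluating at a point -/

/-- Push onto register `7` whether there is a `1` among the first `i` bits of register `0`, where `i`
is the unary number in register `1` of the high registers. -/
def readProg (B : ℕ) : Prog :=
  .seq (.push (B + 7) false) <|
  .seq (prepend (B + 1) (B + 8) (B + 0)) <|
  .loop (B + 8) <| .seq (.pop (B + 8)) <|
    .cond 0 (.pop 0) (.seq (.pop (B + 7)) (.seq (.push (B + 7) true) (.pop 0))) (.pop 0)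

/-- The top of register 7 accumulates the disjunction of the bits read; an output shorter than `i`
bits counts as continued by zeros. What is left in the low registers is irrelevant, since they are
cleared before the next evaluation. -/
theorem exec_readLoop (hB : 0 < B) {l1 l2 l3 l4 l5 l6 F : List Bool} (i : ℕ) (b : Bool) :
    ∃ a', Exec (.loop (B + 8) <| .seq (.pop (B + 8)) <|
      .cond 0 (.pop 0) (.seq (.pop (B + 7)) (.seq (.push (B + 7) true) (.pop 0))) (.pop 0))
      (memOf B a q [[], l1, l2, l3, l4, l5, l6, b :: F, unary i]) (9 * i + 1)
      (memOf B a' q [[], l1, l2, l3, l4, l5, l6, (b || ((a 0).take i).any id) :: F, []]) := by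
  induction i generalizing a b with
  | zero =>
    refine ⟨a, ?_⟩
    simp only [List.take_zero, List.any_nil, Bool.or_false]
    exact (Exec.loop_nil (by rw [memOf_reg_high]; rfl))
  | succ i ih =>
    have h1 : Exec (.pop (B + 8))
        (memOf B a q [[], l1, l2, l3, l4, l5, l6, b :: F, unary (i + 1)]) 1
        (memOf B a q [[], l1, l2, l3, l4, l5, l6, b :: F, unary i]) :=
      exec_pop_high (i := 8) (by simp)
    have hpop := exec_pop_low (a := a) (q := q) hB
      (ls := [[], l1, l2, l3, l4, l5, l6, b :: F, unary i])
    have hne : (memOf B a q [[], l1, l2, l3, l4, l5, l6, b :: F, unary (i + 1)]).reg (B + 8) ≠ [] := by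
      rw [memOf_reg_high]; simp [unary]
    have hreg := memOf_reg_low (a := a) (q := q) hB
      (ls := [[], l1, l2, l3, l4, l5, l6, b :: F, unary i])
    rcases h : a 0 with _ | ⟨_ | _, l⟩
    · obtain ⟨a', ha'⟩ := ih (a := Function.update a 0 (a 0).tail) b
      refine ⟨a', ?_⟩
      rw [Function.update_self, h] at ha'
      simp only [List.tail_nil, List.take_nil] at ha' ⊢
      rw [h] at hpop
      exact (Exec.loop_cons hne (h1.seq (Exec.cond_nil (hreg.trans h) hpop)) ha').mono (by omega)
    · obtain ⟨a', ha'⟩ := ih (a := Function.update a 0 (a 0).tail) b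
      refine ⟨a', ?_⟩
      rw [Function.update_self, h] at ha'
      simp only [List.tail_cons, List.take_succ_cons, List.any_cons, id, Bool.false_or] at ha' ⊢
      rw [h] at hpop
      exact (Exec.loop_cons hne (h1.seq (Exec.cond_false (hreg.trans h) hpop)) ha').mono (by omega)
    · obtain ⟨a', ha'⟩ := ih (a := Function.update a 0 (a 0).tail) true
      refine ⟨a', ?_⟩
      rw [Function.update_self, h] at ha'
      simp only [List.take_succ_cons, List.any_cons, id, Bool.true_or, Bool.or_true] at ha' ⊢
      have e1 : Exec (.pop (B + 7)) (memOf B a q [[], l1, l2, l3, l4, l5, l6, b :: F, unary i]) 1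
          (memOf B a q [[], l1, l2, l3, l4, l5, l6, F, unary i]) := exec_pop_high (i := 7) (by simp)
      have e2 : Exec (.push (B + 7) true) (memOf B a q [[], l1, l2, l3, l4, l5, l6, F, unary i]) 1
          (memOf B a q [[], l1, l2, l3, l4, l5, l6, true :: F, unary i]) :=
        exec_push_high (i := 7) true (by simp)
      have e3 := exec_pop_low (a := a) (q := q) hB
        (ls := [[], l1, l2, l3, l4, l5, l6, true :: F, unary i])
      rw [h] at e3
      exact (Exec.loop_cons hne (h1.seq (Exec.cond_true (hreg.trans h) (e1.seq (e2.seq e3)))) ha').mono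
        (by omega)

theorem exec_readProg (hB : 0 < B) {l2 l3 l4 l5 l6 F : List Bool} (i : ℕ) :
    ∃ a', Exec (readProg B) (memOf B a q [[], unary i, l2, l3, l4, l5, l6, F, []]) (21 * i + 8)
      (memOf B a' q [[], unary i, l2, l3, l4, l5, l6, ((a 0).take i).any id :: F, []]) := by
  obtain ⟨a', h3⟩ := exec_readLoop (a := a) (q := q) hB (l1 := unary i) (l2 := l2) (l3 := l3)
    (l4 := l4) (l5 := l5) (l6 := l6) (F := F) i false
  refine ⟨a', ?_⟩
  have h1 : Exec (.push (B + 7) false) (memOf B a q [[], unary i, l2, l3, l4, l5, l6, F, []]) 1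
      (memOf B a q [[], unary i, l2, l3, l4, l5, l6, false :: F, []]) :=
    exec_push_high (i := 7) false (by simp)
  have h2 : Exec (prepend (B + 1) (B + 8) (B + 0))
      (memOf B a q [[], unary i, l2, l3, l4, l5, l6, false :: F, []]) (12 * (unary i).length + 3)
      (memOf B a q [[], unary i, l2, l3, l4, l5, l6, false :: F, unary i ++ []]) :=
    exec_prepend_high (i := 1) (j := 8) (by omega) (by omega) (by omega) (by simp) rfl
  rw [List.append_nil, length_unary] at h2
  rw [Bool.false_or] at h3
  exact (h1.seq (h2.seq h3)).mono (by omega)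

/-- Prepare the inputs of the evaluator: its description, the point at which to evaluate, and the
precision. -/
def prepareProg (B : ℕ) (M : Model) : Prog :=
  .seq (clearBelow B) <|
  .seq (M.resetProg B) <|
  .seq (.push 1 true) <|
  .seq (prepend (B + 6) 1 (B + 0)) <|
  .seq (prependReverse (B + 5) 1 (B + 0)) <|
  .seq (prepend (B + 3) 1 (B + 0)) <|
  .seq (prepend (B + 4) 0 (B + 0)) (prepend (B + 2) 2 (B + 0))

/-- The point is assembled from its last bit backwards: the final 1, the untouched bits `R`, the
flipped bits `L` in their original order, the padding zeros. -/
theorem exec_prepareProg (hB : 3 ≤ B) (hq : M.Leaves q) {K N Z W L R F : List Bool} {ℓ : ℕ}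
    (hN : N.length ≤ ℓ) (hZ : Z.length ≤ ℓ) (hW : W.length ≤ ℓ) (hL : L.length ≤ ℓ)
    (hR : R.length ≤ ℓ) : Exec (prepareProg B M) (memOf B a q [[], K, N, Z, W, L, R, F, []])
      (60 * ℓ + 2 * B + 30)
      (memOf B (initMem [W, Z ++ (L.reverse ++ R ++ [true]), N]).reg QState.zero
        [[], K, N, Z, W, L, R, F, []]) := by
  have h1 := exec_clearBelow (B := B) (a := a) (q := q) (ls := [[], K, N, Z, W, L, R, F, []])
    (by omega)
  have h2 := exec_resetProg (B := B) (a := fun _ => []) hq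
    (ls := [[], K, N, Z, W, L, R, F, []]) (by simp) rfl
  have h3 := exec_push_low (B := B) (a := fun _ => []) (q := QState.zero)
    (ls := [[], K, N, Z, W, L, R, F, []]) (r := 1) true (by omega)
  have h4 : ∀ (a : ℕ → List Bool) (i r : ℕ), i ≠ 0 → r < B →
      Exec (prepend (B + i) r (B + 0)) (memOf B a QState.zero [[], K, N, Z, W, L, R, F, []])
        (12 * (([[], K, N, Z, W, L, R, F, []] : List (List Bool)).getD i []).length + 3)
        (memOf B (Function.update a r
          (([[], K, N, Z, W, L, R, F, []] : List (List Bool)).getD i [] ++ a r)) QState.zero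
          [[], K, N, Z, W, L, R, F, []]) :=
    fun a i r hi hr => exec_prepend_high_low hr hi rfl
  have h5 : ∀ (a : ℕ → List Bool),
      Exec (prependReverse (B + 5) 1 (B + 0)) (memOf B a QState.zero [[], K, N, Z, W, L, R, F, []])
        (12 * L.length + 3)
        (memOf B (Function.update a 1 (L.reverse ++ a 1)) QState.zero
          [[], K, N, Z, W, L, R, F, []]) :=
    fun a => exec_prependReverse_high_low (i := 5) (by omega) (by omega) rfl
  have h := h1.seq (h2.seq (h3.seq ((h4 _ 6 1 (by omega) (by omega)).seq ((h5 _).seq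
    ((h4 _ 3 1 (by omega) (by omega)).seq ((h4 _ 4 0 (by omega) (by omega)).seq
    (h4 _ 2 2 (by omega) (by omega))))))))
  refine Eq.mp ?_ (h.mono (t' := 60 * ℓ + 2 * B + 30) ?_)
  · congr 2
    rw [initMem_reg_three]
    funext r
    rcases r with _ | _ | _ | r <;> simp
  · simp
    omega

/-- Run `E` as a subroutine; it has no access to the sample oracle. -/
def Prog.withoutSamples (E : Prog) : Prog := E.replaceSample fun r => .clear r

/-- Evaluate at the point given by the registers `3`, `5` and `6` the distribution described by
register `4`, and push the bit that `readProg` yields onto register `7`. -/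
def evalProg (B : ℕ) (M : Model) (E : Prog) : Prog :=
  .seq (prepareProg B M) <| .seq E.withoutSamples (readProg B)

/-- The evaluator uses fresh randomness, so its success probability multiplies the value `v` of what
follows. That value must be guaranteed for whatever low registers and quantum state the evaluator
leaves behind. -/
theorem hit_evalProg {O : PMF (List Bool)} {f : Config → ENNReal} {E : Prog} (hE : M.Allows E)
    (hEB : E.bound ≤ B) (hB : 3 ≤ B) (hq : M.Leaves q) {N Z W L R F : List Bool} {ℓ i T : ℕ}
    (hN : N.length ≤ ℓ) (hZ : Z.length ≤ ℓ) (hW : W.length ≤ ℓ) (hL : L.length ≤ ℓ)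
    (hR : R.length ≤ ℓ) (hi : i ≤ ℓ) {K : List Prog} {bit : Bool} {pr v : ENNReal}
    (hpr : pr ≤ successProb (PMF.pure []) E [W, Z ++ (L.reverse ++ R ++ [true]), N] T
      fun out => (out.take i).any id = bit)
    (hf : ∀ a' q', M.Leaves q' →
      v ≤ f (K, memOf B a' q' [[], unary i, N, Z, W, L, R, bit :: F, []])) :
    pr * v ≤ hit O f (T + (90 * ℓ + 2 * B + 40))
      (evalProg B M E :: K, memOf B a q [[], unary i, N, Z, W, L, R, F, []]) := by
  have h1 := exec_prepareProg (a := a) hB hq (K := unary i) (F := F) hN hZ hW hL hR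
  have h2 := h1.hit_le_seq (O := O) (f := f) (.seq E.withoutSamples (readProg B)) K
    (T + (21 * i + 8) + 1)
  refine le_trans ?_ (h2.trans (hit_mono_time (by omega) _))
  refine le_trans ?_ (hit_seq _ _ _ _ _)
  refine le_trans ?_ (hit_hit_le T (21 * i + 8) _)
  set ls : List (List Bool) := [[], unary i, N, Z, W, L, R, F, []] with hls
  -- Evaluators are specified relative to the oracle that always answers with the empty string, and
  -- `clear` reproduces that answer exactly.
  have h3 := runFor_mul_le_hit (B := B) (ls := ls) (O := O) (O' := PMF.pure [])
    (pad := fun r => .clear r) (cost := 1) le_rfl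
    (by
      intro r hr m f K
      rw [ev_pure]
      refine (Exec.of_step (p := .clear r) (m := m.embed B ls) (m' := (m.set r []).embed B ls)
        fun O K => ?_) O f K
      rw [← Mem.embed_set hr]
      rfl)
    (I := M.Leaves) (K := readProg B :: K) (f := hit O f (21 * i + 8))
    (G := fun m => ((m.reg 0).take i).any id = bit) (a := v)
    (by
      intro m hG hI
      obtain ⟨a', h4⟩ := exec_readProg (a := m.reg) (q := m.qmem) (show 0 < B by omega)
        (l2 := N) (l3 := Z) (l4 := W) (l5 := L) (l6 := R) (F := F) i
      rw [hG] at h4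
      exact (hf a' m.qmem hI).trans (h4 O f K))
    T [E] (initMem [W, Z ++ (L.reverse ++ R ++ [true]), N])
    (by
      intro p hp
      rw [List.mem_singleton] at hp
      subst hp
      exact ⟨hEB, hE.isClassical_or⟩)
    M.leaves_zero
  rw [one_mul] at h3
  exact (mul_le_mul_left hpr v).trans h3

/-! ### Evaluating at neighbouring points -/

/-- Flip the first `i` bits of `x`. -/
def flipBelow {k : ℕ} (x : Fin k → Bool) (i : ℕ) : Fin k → Bool := fun j => xor (x j) (decide (j < i))

/-- The list `g i, …, g 0`. -/
def descending (g : ℕ → Bool) : ℕ → List Bool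
  | 0 => [g 0]
  | i + 1 => g (i + 1) :: descending g i

theorem take_map_not_append_drop {k : ℕ} (x : Fin k → Bool) (i : ℕ) :
    ((List.ofFn x).take i).map not ++ (List.ofFn x).drop i = List.ofFn (flipBelow x i) := by
  refine List.ext_getElem ?_ fun j h1 h2 => ?_
  · simp; omega
  · simp only [List.length_ofFn] at h2
    by_cases hj : j < i
    · rw [List.getElem_append_left (by simp; omega)]
      simp [flipBelow, hj]
    · rw [List.getElem_append_right (by simp; omega)]
      simp [flipBelow, hj]
      congr 2
      omega

/-- Flip the bits one after the other and evaluate after each flip. -/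
def flipLoop (B : ℕ) (M : Model) (E : Prog) : Prog :=
  .loop (B + 6) <| .seq
    (.cond (B + 6) (.pop (B + 6)) (.seq (.push (B + 5) false) (.pop (B + 6)))
      (.seq (.push (B + 5) true) (.pop (B + 6))))
    (evalProg B M E)

/-- Registers 5 and 6 form a zipper: each round moves one bit across, negated, and evaluates at the
new point. Induction on the number `r` of bits still to be moved; each evaluation contributes one
factor `pr`. -/
theorem hit_flipLoop {O : PMF (List Bool)} {f : Config → ENNReal} {E : Prog} (hE : M.Allows E)
    (hEB : E.bound ≤ B) (hB : 3 ≤ B) {N Z W : List Bool} {ℓ k T : ℕ}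
    (hN : N.length ≤ ℓ) (hZ : Z.length ≤ ℓ) (hW : W.length ≤ ℓ) (hk : k + 1 ≤ ℓ) {K : List Prog}
    {pr v : ENNReal} {g : ℕ → Bool} {x : Fin k → Bool}
    (hpr : ∀ i, pr ≤ successProb (PMF.pure []) E
      [W, Z ++ (List.ofFn (flipBelow x i) ++ [true]), N] T
      fun out => (out.take (k + 1)).any id = g i)
    (hf : ∀ a' q' L, L.length = k → M.Leaves q' →
      v ≤ f (K, memOf B a' q' [[], unary (k + 1), N, Z, W, L, [], descending g k, []]))
    (r i : ℕ) (hri : i + r = k) (a : ℕ → List Bool) (q : QState) (hq : M.Leaves q) :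
    pr ^ r * v ≤ hit O f (r * (T + (90 * ℓ + 2 * B + 50)) + 1)
      (flipLoop B M E :: K, memOf B a q [[], unary (k + 1), N, Z, W,
        (((List.ofFn x).take i).map not).reverse, (List.ofFn x).drop i, descending g i, []]) := by
  induction r generalizing i a q with
  | zero =>
    obtain rfl : i = k := by omega
    rw [pow_zero, one_mul, List.drop_of_length_le (by simp)]
    refine (hf a q (((List.ofFn x).take i).map not).reverse (by simp) hq).trans ?_
    exact ((Exec.loop_nil (by rw [memOf_reg_high]; rfl)) O f K).trans (hit_mono_time (by omega) _)
  | succ r ih =>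
    have hik : i < k := by omega
    have hdrop : (List.ofFn x).drop i = x ⟨i, hik⟩ :: (List.ofFn x).drop (i + 1) := by
      rw [List.drop_eq_getElem_cons (by simpa using hik)]
      simp
    have htake : (((List.ofFn x).take (i + 1)).map not).reverse =
        (!x ⟨i, hik⟩) :: (((List.ofFn x).take i).map not).reverse := by
      rw [List.take_succ_eq_append_getElem (by simpa using hik)]
      simp
    rw [hdrop]
    set L := (((List.ofFn x).take i).map not).reverse with hL
    set R := (List.ofFn x).drop (i + 1) with hR
    have hflip : Exec (.cond (B + 6) (.pop (B + 6)) (.seq (.push (B + 5) false) (.pop (B + 6)))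
        (.seq (.push (B + 5) true) (.pop (B + 6))))
        (memOf B a q [[], unary (k + 1), N, Z, W, L, x ⟨i, hik⟩ :: R, descending g i, []]) 4
        (memOf B a q [[], unary (k + 1), N, Z, W, (!x ⟨i, hik⟩) :: L, R, descending g i, []]) := by
      have e1 : ∀ b, Exec (.push (B + 5) b)
          (memOf B a q [[], unary (k + 1), N, Z, W, L, x ⟨i, hik⟩ :: R, descending g i, []]) 1
          (memOf B a q [[], unary (k + 1), N, Z, W, b :: L, x ⟨i, hik⟩ :: R, descending g i, []]) :=
        fun b => exec_push_high (i := 5) b (by simp)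
      have e2 : ∀ b, Exec (.pop (B + 6))
          (memOf B a q [[], unary (k + 1), N, Z, W, b :: L, x ⟨i, hik⟩ :: R, descending g i, []]) 1
          (memOf B a q [[], unary (k + 1), N, Z, W, b :: L, R, descending g i, []]) :=
        fun b => exec_pop_high (i := 6) (by simp)
      have e3 := fun b => (e1 b).seq (e2 b)
      cases hx : x ⟨i, hik⟩ with
      | false =>
        have := e3 true
        rw [hx] at this
        exact Exec.cond_false (by rw [memOf_reg_high]; rfl) this
      | true =>
        have := e3 false
        rw [hx] at this
        exact Exec.cond_true (by rw [memOf_reg_high]; rfl) this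
    have hprog : ∀ a' q', M.Leaves q' → pr ^ r * v ≤
        hit O f (r * (T + (90 * ℓ + 2 * B + 50)) + 1) (flipLoop B M E :: K, memOf B a' q'
          [[], unary (k + 1), N, Z, W, (!x ⟨i, hik⟩) :: L, R, g (i + 1) :: descending g i, []]) := by
      intro a' q' hq'
      have := ih (i + 1) (by omega) a' q' hq'
      rwa [htake] at this
    have hlist : ((!x ⟨i, hik⟩) :: L).reverse ++ R = List.ofFn (flipBelow x (i + 1)) := by
      rw [← take_map_not_append_drop, ← htake, List.reverse_reverse]
    have hev := hit_evalProg (O := O) (a := a) hE hEB hB hq (L := (!x ⟨i, hik⟩) :: L) (R := R)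
      (F := descending g i) (ℓ := ℓ) (i := k + 1) (T := T) (bit := g (i + 1)) hN hZ hW
      (by simp [hL]; omega) (by simp [hR]; omega) hk (pr := pr)
      (by rw [hlist]; exact hpr (i + 1)) hprog
    rw [pow_succ', mul_assoc]
    refine hev.trans ((hit_hit_le _ _ _).trans ?_)
    refine (hflip.hit_le_seq _ _ _).trans ?_
    refine (hit_of_step_pure (step_loop_cons (by rw [memOf_reg_high]; simp) _) _).trans ?_
    refine hit_mono_time ?_ _
    have : (r + 1) * (T + (90 * ℓ + 2 * B + 50)) =
      r * (T + (90 * ℓ + 2 * B + 50)) + (T + (90 * ℓ + 2 * B + 50)) := by ring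
    omega

/-! ### The output -/

/-- Write the differences of consecutive bits of register `7` into register `0`. -/
def outputProg (B : ℕ) : Prog :=
  .seq (.clear 0) <| .loop (B + 5) <| .seq (.pop (B + 5)) <|
    .cond (B + 7) (.pop (B + 7))
      (.seq (.pop (B + 7)) (.cond (B + 7) (.pop (B + 7)) (.push 0 false) (.push 0 true)))
      (.seq (.pop (B + 7)) (.cond (B + 7) (.pop (B + 7)) (.push 0 true) (.push 0 false)))

theorem descending_eq_cons (g : ℕ → Bool) (i : ℕ) : ∃ l, descending g i = g i :: l := by
  cases i <;> exact ⟨_, rfl⟩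

/-- Register 5 serves only as a counter. The newest parity is on top, so the differences are
produced from the last index down, and pushing them puts them in the right order. -/
theorem exec_outputLoop (hB : 0 < B) {l1 l2 l3 l4 l6 l8 : List Bool} (g : ℕ → Bool) (i : ℕ)
    (L : List Bool) (hL : L.length = i) :
    ∃ m', m'.reg 0 = List.ofFn (fun j : Fin i => xor (g (j + 1)) (g j)) ++ a 0 ∧
      Exec (.loop (B + 5) <| .seq (.pop (B + 5)) <|
        .cond (B + 7) (.pop (B + 7))
          (.seq (.pop (B + 7)) (.cond (B + 7) (.pop (B + 7)) (.push 0 false) (.push 0 true)))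
          (.seq (.pop (B + 7)) (.cond (B + 7) (.pop (B + 7)) (.push 0 true) (.push 0 false))))
        (memOf B a q [[], l1, l2, l3, l4, L, l6, descending g i, l8]) (8 * i + 1) m' := by
  induction i generalizing a L with
  | zero =>
    rw [List.length_eq_zero_iff] at hL
    subst hL
    refine ⟨_, ?_, Exec.loop_nil (by rw [memOf_reg_high]; rfl)⟩
    rw [memOf_reg_low hB]
    simp
  | succ i ih =>
    obtain ⟨b, L, rfl⟩ := List.exists_cons_of_length_eq_add_one hL
    obtain ⟨m', h0, h1⟩ := ih (a := Function.update a 0 (xor (g (i + 1)) (g i) :: a 0)) L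
      (by simpa using hL)
    refine ⟨m', ?_, ?_⟩
    · rw [h0, List.ofFn_succ']
      simp
    · have e1 : Exec (.pop (B + 5))
          (memOf B a q [[], l1, l2, l3, l4, b :: L, l6, descending g (i + 1), l8]) 1
          (memOf B a q [[], l1, l2, l3, l4, L, l6, descending g (i + 1), l8]) :=
        exec_pop_high (i := 5) (by simp)
      have e2 : Exec (.pop (B + 7))
          (memOf B a q [[], l1, l2, l3, l4, L, l6, descending g (i + 1), l8]) 1
          (memOf B a q [[], l1, l2, l3, l4, L, l6, descending g i, l8]) :=
        exec_pop_high (i := 7) (by simp)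
      have e3 := fun b => exec_push_low (a := a) (q := q) b hB
        (ls := [[], l1, l2, l3, l4, L, l6, descending g i, l8])
      obtain ⟨l, hl⟩ := descending_eq_cons g i
      have r1 : (memOf B a q [[], l1, l2, l3, l4, L, l6, descending g i, l8]).reg (B + 7) =
          g i :: l := by rw [memOf_reg_high]; exact hl
      have r2 : (memOf B a q [[], l1, l2, l3, l4, L, l6, descending g (i + 1), l8]).reg (B + 7) =
          g (i + 1) :: descending g i := by rw [memOf_reg_high]; rfl
      have hbody : Exec (.seq (.pop (B + 5)) <|
          .cond (B + 7) (.pop (B + 7))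
            (.seq (.pop (B + 7)) (.cond (B + 7) (.pop (B + 7)) (.push 0 false) (.push 0 true)))
            (.seq (.pop (B + 7)) (.cond (B + 7) (.pop (B + 7)) (.push 0 true) (.push 0 false))))
          (memOf B a q [[], l1, l2, l3, l4, b :: L, l6, descending g (i + 1), l8]) 7
          (memOf B (Function.update a 0 (xor (g (i + 1)) (g i) :: a 0)) q
            [[], l1, l2, l3, l4, L, l6, descending g i, l8]) := by
        refine Exec.mono (e1.seq (t' := 5) ?_) le_rfl
        cases h : g (i + 1) <;> rw [h] at r2 <;> cases h' : g i <;> rw [h'] at r1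
        · exact Exec.cond_false r2 (e2.seq (Exec.cond_false r1 (e3 false)))
        · exact Exec.cond_false r2 (e2.seq (Exec.cond_true r1 (e3 true)))
        · exact Exec.cond_true r2 (e2.seq (Exec.cond_false r1 (e3 true)))
        · exact Exec.cond_true r2 (e2.seq (Exec.cond_true r1 (e3 false)))
      exact (Exec.loop_cons (by rw [memOf_reg_high]; simp) hbody h1).mono (by omega)

theorem exec_outputProg (hB : 0 < B) {l1 l2 l3 l4 l6 l8 : List Bool} (g : ℕ → Bool) (i : ℕ)
    (L : List Bool) (hL : L.length = i) :
    ∃ m', m'.reg 0 = List.ofFn (fun j : Fin i => xor (g (j + 1)) (g j)) ∧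
      Exec (outputProg B) (memOf B a q [[], l1, l2, l3, l4, L, l6, descending g i, l8]) (8 * i + 3)
        m' := by
  obtain ⟨m', h0, h1⟩ := exec_outputLoop (a := Function.update a 0 []) (q := q) hB (l1 := l1)
    (l2 := l2) (l3 := l3) (l4 := l4) (l6 := l6) (l8 := l8) g i L hL
  refine ⟨m', by simpa using h0, ?_⟩
  exact ((exec_clear_low hB).seq h1).mono (by omega)

/-! ### Random points -/

/-- Fill register `6` with as many random bits as given by register `1`, less one. -/
def coinProg (B : ℕ) : Prog :=
  .seq (prepend (B + 1) (B + 8) (B + 0)) <| .seq (.pop (B + 8)) <|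
    .loop (B + 8) (.seq (.pop (B + 8)) (.coin (B + 6)))

theorem ev_fairBit (g : Bool → ENNReal) :
    ev (biasedBit (1 / 2)) g = 2⁻¹ * g true + 2⁻¹ * g false := by
  have h : ENNReal.ofReal (1 / 2) = 2⁻¹ := by
    rw [one_div, ENNReal.ofReal_inv_of_pos (by norm_num)]
    simp
  have h1 : min (1 : ℝ) (1 / 2) = 1 / 2 := min_eq_right (by norm_num)
  have h2 : max (0 : ℝ) (1 / 2) = 1 / 2 := max_eq_right (by norm_num)
  have h3 : (1 : ℝ) - 1 / 2 = 1 / 2 := by norm_num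
  unfold ev
  rw [tsum_fintype, Fintype.sum_bool]
  simp only [biasedBit, PMF.ofFintype_apply, h1, h2, h3, h]
  simp

theorem sum_le_hit_coinLoop {O : PMF (List Bool)} {f : Config → ENNReal}
    {l1 l2 l3 l4 l5 l7 : List Bool} {K : List Prog} (k : ℕ) (R : List Bool) :
    (2⁻¹ : ENNReal) ^ k * ∑ x : Fin k → Bool,
      f (K, memOf B a q [[], l1, l2, l3, l4, l5, List.ofFn x ++ R, l7, []]) ≤
    hit O f (4 * k + 1) (.loop (B + 8) (.seq (.pop (B + 8)) (.coin (B + 6))) :: K,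
      memOf B a q [[], l1, l2, l3, l4, l5, R, l7, unary k]) := by
  induction k generalizing R with
  | zero =>
    simp only [pow_zero, one_mul, Finset.univ_unique, Finset.sum_singleton, List.ofFn_zero,
      List.nil_append]
    exact (Exec.loop_nil (by rw [memOf_reg_high]; rfl)) O f K
  | succ k ih =>
    -- The first coin ends up below the later ones, so it is the last coordinate of `x` that is
    -- split off.
    have hsum : ∑ x : Fin (k + 1) → Bool,
        f (K, memOf B a q [[], l1, l2, l3, l4, l5, List.ofFn x ++ R, l7, []]) =
        ∑ b : Bool, ∑ x : Fin k → Bool,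
          f (K, memOf B a q [[], l1, l2, l3, l4, l5, List.ofFn x ++ (b :: R), l7, []]) := by
      rw [← Fintype.sum_prod_type', ← (Fin.snocEquiv fun _ => Bool).sum_comp]
      refine Finset.sum_congr rfl fun y _ => ?_
      have : List.ofFn ((Fin.snocEquiv fun _ => Bool) y) = List.ofFn y.2 ++ [y.1] := by
        rw [List.ofFn_succ']
        simp [Fin.snocEquiv]
      rw [this, List.append_assoc]
      rfl
    rw [hsum, Fintype.sum_bool, pow_succ', mul_assoc, mul_add, mul_add]
    have e1 : Exec (.pop (B + 8)) (memOf B a q [[], l1, l2, l3, l4, l5, R, l7, unary (k + 1)]) 1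
        (memOf B a q [[], l1, l2, l3, l4, l5, R, l7, unary k]) := exec_pop_high (i := 8) (by simp)
    set P : Prog := .loop (B + 8) (.seq (.pop (B + 8)) (.coin (B + 6))) with hP
    have e2 : ev (biasedBit (1 / 2)) (fun b => hit O f (4 * k + 1)
        (P :: K, memOf B a q [[], l1, l2, l3, l4, l5, b :: R, l7, unary k])) ≤
        hit O f (4 * k + 2)
          (.coin (B + 6) :: P :: K, memOf B a q [[], l1, l2, l3, l4, l5, R, l7, unary k]) := by
      refine hit_of_step_map (g := fun b => (P :: K,
        memOf B a q [[], l1, l2, l3, l4, l5, b :: R, l7, unary k])) ?_ _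
      simp only [step]
      congr 1
      funext b
      rw [memOf_set_high (by simp), memOf_reg_high]
      rfl
    rw [ev_fairBit] at e2
    refine (add_le_add (mul_le_mul_right (ih (true :: R)) _)
      (mul_le_mul_right (ih (false :: R)) _)).trans (e2.trans ?_)
    refine (e1.hit_le_seq _ _ _).trans ?_
    refine (hit_of_step_pure (step_loop_cons (by rw [memOf_reg_high]; simp [unary]) _) _).trans ?_
    exact hit_mono_time (by omega) _

theorem sum_le_hit_coinProg {O : PMF (List Bool)} {f : Config → ENNReal}
    {l2 l3 l4 l5 l7 : List Bool} {K : List Prog} (k : ℕ) :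
    (2⁻¹ : ENNReal) ^ k * ∑ x : Fin k → Bool,
      f (K, memOf B a q [[], unary (k + 1), l2, l3, l4, l5, List.ofFn x, l7, []]) ≤
    hit O f (16 * k + 20) (coinProg B :: K,
      memOf B a q [[], unary (k + 1), l2, l3, l4, l5, [], l7, []]) := by
  have h1 : Exec (prepend (B + 1) (B + 8) (B + 0))
      (memOf B a q [[], unary (k + 1), l2, l3, l4, l5, [], l7, []])
      (12 * (unary (k + 1)).length + 3)
      (memOf B a q [[], unary (k + 1), l2, l3, l4, l5, [], l7, unary (k + 1) ++ []]) :=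
    exec_prepend_high (i := 1) (j := 8) (by omega) (by omega) (by omega) (by simp) rfl
  rw [List.append_nil, length_unary] at h1
  have h2 : Exec (.pop (B + 8))
      (memOf B a q [[], unary (k + 1), l2, l3, l4, l5, [], l7, unary (k + 1)]) 1
      (memOf B a q [[], unary (k + 1), l2, l3, l4, l5, [], l7, unary k]) :=
    exec_pop_high (i := 8) (by simp)
  have h3 := sum_le_hit_coinLoop (O := O) (f := f) (B := B) (a := a) (q := q)
    (l1 := unary (k + 1)) (l2 := l2) (l3 := l3) (l4 := l4) (l5 := l5) (l7 := l7) (K := K) k []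
  simp only [List.append_nil] at h3
  refine h3.trans ((h2.hit_le_seq _ _ _).trans ((h1.hit_le_seq _ _ _).trans ?_))
  exact hit_mono_time (by omega) _

end pieces

/-! ### Reading off the parity from an evaluator -/

/-- The two points differ in bit `i` only. The proof compares parities of prefixes: they agree up to
`i` and differ by `s i` afterwards. -/
theorem xor_parity_flipBelow {k : ℕ} (s x : Fin k → Bool) (i : Fin k) :
    xor (parity s (flipBelow x (i + 1))) (parity s (flipBelow x i)) = s i := by
  have key : ∀ m ≤ k, xor (parityBelow (extendZero s) (extendZero (flipBelow x (i + 1))) m)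
      (parityBelow (extendZero s) (extendZero (flipBelow x i)) m) = (decide (i.val < m) && s i) := by
    intro m hm
    induction m with
    | zero => rfl
    | succ m ih =>
      have h := ih (by omega)
      rw [parityBelow_succ, parityBelow_succ, extendZero_of_lt s (show m < k by omega),
        extendZero_of_lt _ (show m < k by omega), extendZero_of_lt _ (show m < k by omega)]
      simp only [flipBelow]
      rcases lt_trichotomy i.val m with h1 | h1 | h1
      · have h2 : ¬ m < i.val + 1 := by omega
        have h3 : ¬ m < i.val := by omega
        have h4 : i.val < m + 1 := by omega
        simp only [h1, h2, h3, h4, decide_true, decide_false] at h ⊢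
        rw [← h]
        generalize parityBelow _ _ m = u
        generalize parityBelow _ _ m = v
        cases u <;> cases v <;> cases s ⟨m, by omega⟩ <;> cases x ⟨m, by omega⟩ <;> rfl
      · have h2 : m < i.val + 1 := by omega
        have h3 : ¬ m < i.val := by omega
        have h4 : i.val < m + 1 := by omega
        have h5 : ¬ i.val < m := by omega
        have h6 : (⟨m, by omega⟩ : Fin k) = i := Fin.ext h1.symm
        simp only [h5, h2, h3, h4, h6, decide_true, decide_false] at h ⊢
        generalize parityBelow _ _ m = u at *
        generalize parityBelow _ _ m = v at *
        cases u <;> cases v <;> cases s i <;> cases x i <;> simp at *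
      · have h2 : m < i.val + 1 := by omega
        have h4 : ¬ i.val < m + 1 := by omega
        have h5 : ¬ i.val < m := by omega
        simp only [h1, h2, h4, h5, decide_true, decide_false] at h ⊢
        generalize parityBelow _ _ m = u at *
        generalize parityBelow _ _ m = v at *
        cases u <;> cases v <;> simp at *
  have h := key k le_rfl
  rw [← parity_eq_parityBelow, ← parity_eq_parityBelow] at h
  simpa using h

theorem flipBelow_flipBelow {k : ℕ} (x : Fin k → Bool) (i : ℕ) :
    flipBelow (flipBelow x i) i = x := by
  funext j
  simp [flipBelow]

theorem flipBelow_of_le {k : ℕ} (x : Fin k → Bool) {i : ℕ} (h : k ≤ i) :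
    flipBelow x i = flipBelow x k := by
  funext j
  have : j.val < i := by omega
  simp [flipBelow, this]

theorem binaryFrac_nonneg (l : List Bool) : 0 ≤ binaryFrac l := by
  induction l with
  | nil => exact le_rfl
  | cons b l ih => simp only [binaryFrac]; split_ifs <;> linarith

theorem binaryFrac_lt_one (l : List Bool) : binaryFrac l < 1 := by
  induction l with
  | nil => simp [binaryFrac]
  | cons b l ih => simp only [binaryFrac]; split_ifs <;> linarith

/-- Comparison with 2⁻ⁱ needs no arithmetic, only a look at the first `i` digits. A finite expansion
is strictly below 1, so digits after the `i`-th cannot make up for zeros before. -/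
theorem any_take_iff_le_binaryFrac (l : List Bool) (i : ℕ) :
    (l.take i).any id = true ↔ (1 / 2 : ℝ) ^ i ≤ binaryFrac l := by
  induction i generalizing l with
  | zero =>
    have := binaryFrac_lt_one l
    simp [this]
  | succ i ih =>
    cases l with
    | nil => simp [binaryFrac]
    | cons b l =>
      have h0 := binaryFrac_nonneg l
      cases b with
      | true =>
        have : (1 / 2 : ℝ) ^ i ≤ 1 := pow_le_one₀ (by norm_num) (by norm_num)
        simp only [List.take_succ_cons, List.any_cons, id, Bool.true_or, true_iff, binaryFrac,
          if_true, pow_succ]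
        linarith
      | false =>
        simp only [List.take_succ_cons, List.any_cons, id, Bool.false_or, binaryFrac, pow_succ]
        rw [ih l]
        simp only [Bool.false_eq_true, if_false]
        constructor <;> intro h <;> linarith

/-- An approximation of a value that is close to the probability of `(x, 1)` reveals the parity. -/
theorem any_take_eq_parity (p : ℕ) {k m : ℕ} (s x : Fin k → Bool) (hm : k + 4 ≤ m) {v : ℝ}
    (hv : |(paddedParity p s noiseRate (padVec p x true)).toReal - v| < 1 / 5 * (1 / 2) ^ k)
    {out : List Bool} (hout : |binaryFrac out - v| ≤ (1 / 2) ^ m) :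
    (out.take (k + 1)).any id = parity s x := by
  have hη := noiseRate_pos
  have hη' := noiseRate_le
  rw [paddedParity_apply_padVec p s hη.le (by linarith)] at hv
  have h2 : (0 : ℝ) < (1 / 2) ^ k := by positivity
  have h3 : (1 / 2 : ℝ) ^ m ≤ (1 / 2) ^ k * (1 / 16) := by
    calc (1 / 2 : ℝ) ^ m ≤ (1 / 2) ^ (k + 4) := pow_le_pow_of_le_one (by norm_num) (by norm_num) hm
      _ = _ := by rw [pow_add]; norm_num
  have h4 := abs_lt.1 hv
  have h5 := abs_le.1 hout
  -- In units of 2⁻ᵏ the threshold is 1/2. For parity 0 the output is at most 3/20 + 1/5 + 1/16 <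
  -- 1/2, for parity 1 at least 17/20 - 1/5 - 1/16 > 1/2.
  rw [Bool.eq_iff_iff, any_take_iff_le_binaryFrac, pow_succ]
  cases h : parity s x
  · rw [h] at h4
    simp only [Bool.xor_false, if_true] at h4
    simp only [Bool.false_eq_true, iff_false, not_le]
    nlinarith
  · rw [h] at h4
    simp only [Bool.xor_true, Bool.not_true, Bool.false_eq_true, if_false] at h4
    simp only [iff_true]
    nlinarith

/-! ### Counting bad points and recovering the parity -/

/-- The points `x` at which `Q` is far from the padded noisy parity distribution. -/
def badPoints (p : ℕ) {k : ℕ} (s : Fin k → Bool) (Q : PMF (Fin (p + (k + 1)) → Bool)) :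
    Finset (Fin k → Bool) :=
  {x | 1 / 5 * (1 / 2) ^ k ≤ |(paddedParity p s noiseRate (padVec p x true)).toReal -
    (Q (padVec p x true)).toReal|}

/-- Markov's inequality: distinct bad points contribute at least 2⁻ᵏ/5 each to the ℓ¹ distance,
which is twice the total variation distance. -/
theorem card_badPoints_mul_le (p : ℕ) {k : ℕ} (s : Fin k → Bool)
    (Q : PMF (Fin (p + (k + 1)) → Bool)) :
    ((badPoints p s Q).card : ℝ) * (1 / 2) ^ k ≤ 10 * tv (paddedParity p s noiseRate) Q := by
  set P := paddedParity p s noiseRate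
  have h1 : ((badPoints p s Q).card : ℝ) * (1 / 5 * (1 / 2) ^ k) ≤
      ∑ x ∈ badPoints p s Q, |(P (padVec p x true)).toReal - (Q (padVec p x true)).toReal| := by
    rw [← nsmul_eq_mul]
    exact Finset.card_nsmul_le_sum _ _ _ fun x hx => (Finset.mem_filter.1 hx).2
  have h2 : ∑ x ∈ badPoints p s Q, |(P (padVec p x true)).toReal - (Q (padVec p x true)).toReal| ≤
      ∑ z, |(P z).toReal - (Q z).toReal| := by
    rw [← Finset.sum_image (f := fun z => |(P z).toReal - (Q z).toReal|)
      (g := fun x => padVec p x true) (fun x _ y _ h => (padVec_injective p h).1)]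
    exact Finset.sum_le_sum_of_subset_of_nonneg (Finset.subset_univ _) fun _ _ _ => abs_nonneg _
  unfold tv
  linarith

/-- The points `x` for which some `flipBelow x i` is bad. -/
def badStarts (p : ℕ) {k : ℕ} (s : Fin k → Bool) (Q : PMF (Fin (p + (k + 1)) → Bool)) :
    Finset (Fin k → Bool) :=
  (Finset.range (k + 1)).biUnion fun i => (badPoints p s Q).image fun x => flipBelow x i

theorem card_badStarts_le (p : ℕ) {k : ℕ} (s : Fin k → Bool)
    (Q : PMF (Fin (p + (k + 1)) → Bool)) :
    (badStarts p s Q).card ≤ (k + 1) * (badPoints p s Q).card := by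
  have := Finset.card_biUnion_le_card_mul (Finset.range (k + 1))
    (fun i => (badPoints p s Q).image fun x => flipBelow x i) (badPoints p s Q).card
    (fun i _ => Finset.card_image_le)
  rwa [Finset.card_range] at this

/-- Flipping is an involution, so a start with a bad flip is the flip of a bad point; for `i > k`
nothing new arises. -/
theorem flipBelow_notMem_badPoints {p k : ℕ} {s : Fin k → Bool}
    {Q : PMF (Fin (p + (k + 1)) → Bool)} {x : Fin k → Bool} (hx : x ∉ badStarts p s Q) (i : ℕ) :
    flipBelow x i ∉ badPoints p s Q := by
  have key : ∀ i ≤ k, flipBelow x i ∉ badPoints p s Q := by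
    intro i hi h
    apply hx
    simp only [badStarts, Finset.mem_biUnion, Finset.mem_range, Finset.mem_image]
    exact ⟨i, by omega, _, h, flipBelow_flipBelow x i⟩
  rcases le_total i k with h | h
  · exact key i h
  · rw [flipBelow_of_le x h]
    exact key k le_rfl

theorem successProb_mono {O : PMF (List Bool)} {A : Prog} {inputs : List (List Bool)} {t : ℕ}
    {good good' : List Bool → Prop} (h : ∀ l, good l → good' l) :
    successProb O A inputs t good ≤ successProb O A inputs t good' := by
  refine PMF.toOuterMeasure_mono _ ?_
  rintro c ⟨⟨h1, h2⟩, _⟩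
  exact ⟨h1, h _ h2⟩

/-- Recover the parity function from the evaluator described by register `4`. -/
def recoverProg (B : ℕ) (M : Model) (E : Prog) : Prog :=
  .seq (coinProg B) <| .seq (evalProg B M E) <| .seq (flipLoop B M E) (outputProg B)

/-- The first factor bounds the fraction of starting points all of whose flips are good, by a union
bound over k + 1 flips; the second bounds the probability that all k + 1 evaluations succeed. -/
theorem le_hit_recoverProg {O : PMF (List Bool)} {f : Config → ENNReal} {M : Model} {E : Prog}
    {B p k N : ℕ} {s : Fin k → Bool} {Q : PMF (Fin (p + (k + 1)) → Bool)} (hN : N = p + (k + 1))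
    (hE : M.Allows E) (hEB : E.bound ≤ B) (hB : 3 ≤ B)
    (hp : 3 ≤ p) {w : List Bool} {T : ℕ → ℕ}
    (htv : tv (paddedParity p s noiseRate) Q < 1 / N) (hw : IsEvaluator E w T Q)
    {ℓ : ℕ} (hℓ : N ≤ ℓ) (hwℓ : w.length ≤ ℓ)
    (hf : ∀ m, m.reg 0 = List.ofFn s → 1 ≤ f ([], m)) {a : ℕ → List Bool} {q : QState}
    (hq : M.Leaves q) :
    ENNReal.ofReal (1 - 10 * (k + 1) / N) *
      ENNReal.ofReal (1 - (k + 1) / N) ≤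
      hit O f ((k + 1) * (T N + (90 * ℓ + 2 * B + 50)) + 30 * k + 40)
        ([recoverProg B M E], memOf B a q [[], unary (k + 1), unary N,
          List.replicate p false, w, [], [], [], []]) := by
  set Z := List.replicate p false with hZ
  set t := T N with ht
  set pr := ENNReal.ofReal (1 - (1 / 2) ^ N) with hpr_def
  have hNlen : (unary N).length ≤ ℓ := by rw [length_unary]; exact hℓ
  have hZlen : Z.length ≤ ℓ := by simp [hZ]; omega
  have hpoint : ∀ x ∉ badStarts p s Q, ∀ i, pr ≤ successProb (PMF.pure []) E
      [w, Z ++ (List.ofFn (flipBelow x i) ++ [true]), unary N] t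
      fun out => (out.take (k + 1)).any id = parity s (flipBelow x i) := by
    intro x hx i
    have h1 := hw (padVec p (flipBelow x i) true) N
    rw [ofFn_padVec] at h1
    refine h1.trans (successProb_mono fun out hout => ?_)
    have h2 := flipBelow_notMem_badPoints hx i
    simp only [badPoints, Finset.mem_filter, Finset.mem_univ, true_and, not_le] at h2
    -- The precision requested is N = p + k + 1, which is at least k + 4 because 3 ≤ p.
    exact any_take_eq_parity p s _ (by omega) h2 hout
  have hgood : ∀ x ∉ badStarts p s Q, pr ^ (k + 1) ≤
      hit O f ((k + 1) * (t + (90 * ℓ + 2 * B + 50)) + 8 * k + 10)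
        ([.seq (evalProg B M E) <| .seq (flipLoop B M E) (outputProg B)],
          memOf B a q [[], unary (k + 1), unary N, Z, w, [], List.ofFn x, [], []]) := by
    intro x hx
    set g : ℕ → Bool := fun i => parity s (flipBelow x i) with hg
    have hout : ∀ a' q' L, L.length = k → M.Leaves q' → 1 ≤ hit O f (8 * k + 3)
        ([outputProg B], memOf B a' q' [[], unary (k + 1), unary N, Z, w, L, [], descending g k, []])
        := by
      intro a' q' L hL _
      obtain ⟨m', h0, h1⟩ := exec_outputProg (a := a') (q := q') (show 0 < B by omega)
        (l1 := unary (k + 1)) (l2 := unary N) (l3 := Z) (l4 := w) (l6 := []) (l8 := []) g k L hL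
      refine (hf m' ?_).trans (h1 O f [])
      rw [h0]
      congr 1
      funext j
      exact xor_parity_flipBelow s x j
    have hloop : ∀ a' q', M.Leaves q' → pr ^ k * 1 ≤
        hit O f (k * (t + (90 * ℓ + 2 * B + 50)) + 1 + (8 * k + 3) + 1)
          ([.seq (flipLoop B M E) (outputProg B)], memOf B a' q'
            [[], unary (k + 1), unary N, Z, w, [], List.ofFn x, [g 0], []]) := by
      intro a' q' hq'
      have h := hit_flipLoop (O := O) (f := hit O f (8 * k + 3)) hE hEB hB hNlen hZlen hwℓ
        (show k + 1 ≤ ℓ by omega) (K := [outputProg B]) (pr := pr) (v := 1) (g := g) (x := x) (T := t)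
        (hpoint x hx) hout k 0 (by omega) a' q' hq'
      exact h.trans ((hit_hit_le _ _ _).trans (hit_seq _ _ _ _ _))
    have hev := hit_evalProg (O := O) (a := a) hE hEB hB hq (N := unary N) (Z := Z) (W := w)
      (L := []) (R := List.ofFn x) (F := []) (ℓ := ℓ) (i := k + 1) (T := t) (bit := g 0) hNlen hZlen
      hwℓ (by simp) (by simp; omega) (by omega) (pr := pr)
      (by
        have h0 : flipBelow x 0 = x := by funext j; simp [flipBelow]
        have := hpoint x hx 0
        rw [h0] at this
        simpa [hg, h0] using this) hloop
    rw [pow_succ', ← mul_one (pr ^ k)]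
    refine hev.trans ((hit_hit_le _ _ _).trans ((hit_seq _ _ _ _ _).trans (hit_mono_time ?_ _)))
    have : (k + 1) * (t + (90 * ℓ + 2 * B + 50)) =
      k * (t + (90 * ℓ + 2 * B + 50)) + (t + (90 * ℓ + 2 * B + 50)) := by ring
    omega
  have hcoin := sum_le_hit_coinProg (O := O)
    (f := hit O f ((k + 1) * (t + (90 * ℓ + 2 * B + 50)) + 8 * k + 10)) (B := B) (a := a) (q := q)
    (l2 := unary N) (l3 := Z) (l4 := w) (l5 := []) (l7 := [])
    (K := [.seq (evalProg B M E) <| .seq (flipLoop B M E) (outputProg B)]) k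
  refine le_trans ?_ (hcoin.trans ((hit_hit_le _ _ _).trans
    ((hit_seq _ _ _ _ _).trans (hit_mono_time (by omega) _))))
  have hsum : ((badStarts p s Q)ᶜ.card : ENNReal) * pr ^ (k + 1) ≤ ∑ x : Fin k → Bool,
      hit O f ((k + 1) * (t + (90 * ℓ + 2 * B + 50)) + 8 * k + 10)
        ([.seq (evalProg B M E) <| .seq (flipLoop B M E) (outputProg B)],
          memOf B a q [[], unary (k + 1), unary N, Z, w, [], List.ofFn x, [], []]) := by
    rw [← nsmul_eq_mul]
    refine (Finset.card_nsmul_le_sum _ _ _ fun x hx => hgood x (Finset.mem_compl.1 hx)).trans ?_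
    exact Finset.sum_le_sum_of_subset (Finset.subset_univ _)
  refine le_trans ?_ (mul_le_mul_right hsum _)
  rw [← mul_assoc]
  have hNpos : (0 : ℝ) < N := by simp [hN]; positivity
  refine mul_le_mul' ?_ ?_
  · have h1 : (2⁻¹ : ENNReal) ^ k * ((badStarts p s Q)ᶜ.card : ENNReal) =
        ENNReal.ofReal ((1 / 2) ^ k * (badStarts p s Q)ᶜ.card) := by
      rw [ENNReal.ofReal_mul (by positivity), ENNReal.ofReal_pow (by norm_num), one_div,
        ENNReal.ofReal_inv_of_pos (by norm_num), ENNReal.ofReal_natCast]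
      simp
    rw [h1]
    refine ENNReal.ofReal_le_ofReal ?_
    have h2 : ((badStarts p s Q)ᶜ.card : ℝ) = 2 ^ k - (badStarts p s Q).card := by
      rw [Finset.card_compl, Nat.cast_sub (Finset.card_le_univ _)]
      simp
    have h3 : ((badStarts p s Q).card : ℝ) ≤ (k + 1) * (badPoints p s Q).card := by
      exact_mod_cast card_badStarts_le p s Q
    have h4 := card_badPoints_mul_le p s Q
    have h5 : (1 / 2 : ℝ) ^ k * 2 ^ k = 1 := by rw [← mul_pow]; norm_num
    rw [h2, mul_sub, h5]
    have h6 : (1 / 2 : ℝ) ^ k * (badStarts p s Q).card ≤ (k + 1) * (10 * (1 / N)) := by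
      calc (1 / 2 : ℝ) ^ k * (badStarts p s Q).card
          ≤ (1 / 2 : ℝ) ^ k * ((k + 1) * (badPoints p s Q).card) := by gcongr
        _ = (k + 1) * ((badPoints p s Q).card * (1 / 2) ^ k) := by ring
        _ ≤ (k + 1) * (10 * (1 / N)) :=
          mul_le_mul_of_nonneg_left (by linarith) (by positivity)
    have h7 : (10 * (k + 1) / N : ℝ) = (k + 1) * (10 * (1 / N)) := by ring
    linarith
  · have h1 : (1 / 2 : ℝ) ^ N ≤ 1 / N := by
      rw [one_div_pow]
      refine one_div_le_one_div_of_le hNpos ?_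
      exact_mod_cast N.lt_two_pow_self.le
    have h2 : (1 / 2 : ℝ) ^ N ≤ 1 := pow_le_one₀ (by norm_num) (by norm_num)
    rw [hpr_def, ← ENNReal.ofReal_pow (by linarith)]
    refine ENNReal.ofReal_le_ofReal ?_
    -- Bernoulli's inequality for k + 1 evaluations, each failing with probability at most 2⁻ᴺ ≤
    -- 1/N.
    have h3 := one_add_mul_le_pow (a := -(1 / 2 : ℝ) ^ N) (by linarith) (k + 1)
    have h4 : ((k : ℝ) + 1) * (1 / 2) ^ N ≤ (k + 1) * (1 / N) := by gcongr
    have h5 : ((k : ℝ) + 1) / N = (k + 1) * (1 / N) := by ring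
    have h6 : (1 + -(1 / 2 : ℝ) ^ N) = 1 - (1 / 2) ^ N := by ring
    rw [h6] at h3
    push_cast at h3
    linarith


/-! ### The reduction -/

/-- Query the sample oracle and prepend the content of register `3` to the answer. -/
def paddedSample (B r : ℕ) : Prog := .seq (.sample r) (prepend (B + 3) r (B + 0))

/-- Learning parities with noise by means of a distribution learner `A` and an interpreter `E` of
evaluators. -/
def lpnProg (M : Model) (A E : Prog) (B c j : ℕ) : Prog :=
  .seq (setupProg B c j) <|
  .seq (A.replaceSample (paddedSample B)) <|
  .seq (prepend 0 (B + 4) (B + 0)) (recoverProg B M E)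

theorem isClassical_prepend (s d t : ℕ) : (prepend s d t).IsClassical := by
  simp [prepend, moveTo, moveToBoth, Prog.IsClassical]

theorem isClassical_prependReverse (s d t : ℕ) : (prependReverse s d t).IsClassical := by
  simp [prependReverse, moveTo, moveToBoth, Prog.IsClassical]

theorem isClassical_clearBelow (n : ℕ) : (clearBelow n).IsClassical := by
  induction n with
  | zero => trivial
  | succ n ih => exact ⟨trivial, ih⟩

theorem isClassical_pushOnes (B n : ℕ) : (pushOnes B n).IsClassical := by
  induction n with
  | zero => trivial
  | succ n ih => exact ⟨trivial, ih⟩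

theorem isClassical_powProg (B n : ℕ) : (powProg B n).IsClassical := by
  induction n with
  | zero => trivial
  | succ n ih => exact ⟨ih, by simp [mulProg, Prog.IsClassical, isClassical_prepend]⟩

theorem isClassical_evalProg {E : Prog} (hE : E.IsClassical) (B : ℕ) :
    (evalProg B .classical E).IsClassical := by
  have : E.withoutSamples.IsClassical :=
    hE.replaceSample (pad := fun r => .clear r) fun _ => trivial
  simp [evalProg, prepareProg, readProg, Model.resetProg, Prog.IsClassical, isClassical_prepend,
    isClassical_prependReverse, isClassical_clearBelow, this]

theorem isClassical_lpnProg {A E : Prog} (hA : A.IsClassical) (hE : E.IsClassical) (B c j : ℕ) :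
    (lpnProg .classical A E B c j).IsClassical := by
  have h1 : (A.replaceSample (paddedSample B)).IsClassical :=
    hA.replaceSample fun r => by simp [paddedSample, Prog.IsClassical, isClassical_prepend]
  simp [lpnProg, setupProg, zerosProg, recoverProg, coinProg, flipLoop, outputProg,
    Prog.IsClassical, isClassical_prepend, isClassical_clearBelow, isClassical_pushOnes,
    isClassical_powProg, isClassical_evalProg hE, h1]

theorem allows_lpnProg {M : Model} {A E : Prog} (hA : M.Allows A) (hE : M.Allows E) (B c j : ℕ) :
    M.Allows (lpnProg M A E B c j) := by
  cases M
  · exact isClassical_lpnProg hA hE B c j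
  · trivial

/-! ### Success probability and running time of the reduction -/

theorem ev_le_hit_paddedSample {O : PMF (List Bool)} {B p : ℕ} {ls : List (List Bool)}
    (h0 : ls.getD 0 [] = []) (h3 : ls.getD 3 [] = List.replicate p false) (r : ℕ) (hr : r < B)
    (m : Mem) (f : Config → ENNReal) (K : List Prog) :
    ev (O.map (List.replicate p false ++ ·)) (fun l => f (K, (m.set r l).embed B ls)) ≤
      hit O f (12 * p + 6) (paddedSample B r :: K, m.embed B ls) := by
  rw [ev_map]
  have h1 : ∀ l, f (K, (m.set r (List.replicate p false ++ l)).embed B ls) ≤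
      hit O f (12 * p + 3) (prepend (B + 3) r (B + 0) :: K, (m.set r l).embed B ls) := by
    intro l
    have h := exec_prepend_high_low (B := B) (a := (m.set r l).reg) (q := m.qmem) (ls := ls) (i := 3)
      hr (by omega) h0
    rw [h3, List.length_replicate] at h
    refine le_trans (le_of_eq ?_) (h O f K)
    congr 2
    rw [Mem.embed]
    congr 1
    funext i
    by_cases hi : i = r <;> simp [hi]
  refine (ev_mono _ h1).trans ?_
  have h2 : step O (.sample r :: prepend (B + 3) r (B + 0) :: K, m.embed B ls) =
      O.map fun l => (prepend (B + 3) r (B + 0) :: K, (m.set r l).embed B ls) := by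
    simp only [step, Mem.embed_set hr]
  exact (hit_of_step_map h2 _).trans ((hit_seq _ _ _ _ _).trans (hit_mono_time (by omega) _))

theorem length_of_mem_support_samp {n : ℕ} {P : PMF (Fin n → Bool)} {l : List Bool}
    (hl : l ∈ (samp P).support) : l.length = n := by
  rw [samp, PMF.support_map] at hl
  obtain ⟨x, _, rfl⟩ := hl
  simp

theorem ofReal_le_mul_mul_ofReal {a b c d : ℝ} (ha : 0 ≤ a) (hb : 0 ≤ b) (hc : 0 ≤ c)
    (hc' : c ≤ 1) (ha' : a ≤ 1) (hb' : b ≤ 1) (h : a + b + c ≤ d) :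
    ENNReal.ofReal (1 - d) ≤
      ENNReal.ofReal (1 - a) * (ENNReal.ofReal (1 - b) * ENNReal.ofReal (1 - c)) := by
  rw [← ENNReal.ofReal_mul (by linarith), ← ENNReal.ofReal_mul (by linarith)]
  refine ENNReal.ofReal_le_ofReal ?_
  nlinarith [mul_nonneg ha hb, mul_nonneg hb hc, mul_nonneg ha hc,
    mul_nonneg (mul_nonneg ha hb) (sub_nonneg.2 hc'), mul_nonneg (mul_nonneg hb hc) (sub_nonneg.2 ha')]

/-- The running time of `lpnProg` in terms of the size `N` of the learning problem. -/
def lpnTime (B j : ℕ) (t : Polynomial ℕ) : Polynomial ℕ :=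
  let X := Polynomial.X
  Polynomial.C (51 * j + 2 * B + 300) * X + (12 * X + 6) * t.comp (3 * X) +
    12 * (X + t.comp (3 * X)) +
    (X + 1) * (t.comp (4 * X) + (90 * (X + t.comp (3 * X)) + Polynomial.C (2 * B + 50))) +
    30 * X + 50

theorem lpnTime_eval (B j : ℕ) (t : Polynomial ℕ) (N : ℕ) : (lpnTime B j t).eval N =
    (51 * j + 2 * B + 300) * N + (12 * N + 6) * t.eval (3 * N) + 12 * (N + t.eval (3 * N)) +
      (N + 1) * (t.eval (4 * N) + (90 * (N + t.eval (3 * N)) + (2 * B + 50))) + 30 * N + 50 := by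
  simp [lpnTime, Polynomial.eval_comp]

/-- Chains the setup, the simulated learner and the recovery. The learner's success event, sharpened
by the length bound on its output, is exactly what the recovery needs as its starting point. -/
theorem le_successProb_lpnProg {M : Model} {A E : Prog} (hA : M.Allows A) (hE : M.Allows E)
    {t : Polynomial ℕ} {B c j k D p N : ℕ} (hAB : A.bound ≤ B) (hEB : E.bound ≤ B) (hB : 3 ≤ B)
    (s : Fin k → Bool) (hN : (k + D + c) ^ j = N) (hpN : N = p + (k + 1)) (hp : 3 ≤ p)
    (hkN : k + D + c ≤ N) (hDN : 12 * (k + 1) * D ≤ N) (hD : 1 ≤ D)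
    (hlearn : ENNReal.ofReal (1 - 1 / N) ≤
      successProb (samp (paddedParity p s noiseRate)) A [unary N, unary N, unary N]
        (t.eval (N + N + N)) (fun w => ∃ Q : PMF (Fin (p + (k + 1)) → Bool),
          tv (paddedParity p s noiseRate) Q < 1 / N ∧
            IsEvaluator E w (fun m => t.eval (N + N + N + m)) Q)) :
    ENNReal.ofReal (1 - 1 / D) ≤ successProb (noisyParity s noiseRate) (lpnProg M A E B c j)
      [unary k, unary D] ((lpnTime B j t).eval N) (fun out => out = List.ofFn s) := by
  classical
  set O := noisyParity s noiseRate
  set f : Config → ENNReal := fun c => if c.1 = [] ∧ c.2.reg 0 = List.ofFn s then 1 else 0 with hf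
  refine le_trans ?_ (hit_le_successProb (f := f) _ _ _ (fun c => ?_) fun c hc => if_neg hc)
  swap
  · simp only [hf]
    split_ifs <;> simp
  have hNpos : (0 : ℝ) < N := by
    have : 0 < N := by omega
    exact_mod_cast this
  have hDpos : (0 : ℝ) < D := by exact_mod_cast hD
  have h12 : (12 : ℝ) * (k + 1) * D ≤ N := by exact_mod_cast hDN
  have h1D : (1 : ℝ) ≤ D := by exact_mod_cast hD
  have h12' : (12 : ℝ) * (k + 1) ≤ N := by nlinarith
  -- The failures of learner, starting point and evaluations add up to (1 + 11(k + 1))/N ≤ 12(k +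
  -- 1)/N ≤ 1/D.
  have hnum : ENNReal.ofReal (1 - 1 / D) ≤ ENNReal.ofReal (1 - 1 / N) *
      (ENNReal.ofReal (1 - 10 * (k + 1) / N) * ENNReal.ofReal (1 - (k + 1) / N)) := by
    have hk : (0 : ℝ) ≤ k := by positivity
    refine ofReal_le_mul_mul_ofReal (by positivity) (by positivity) (by positivity) ?_ ?_ ?_ ?_
    · rw [div_le_one hNpos]; linarith
    · rw [div_le_one hNpos]; linarith
    · rw [div_le_one hNpos]; linarith
    · rw [← add_div, ← add_div, div_le_div_iff₀ hNpos hDpos]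
      nlinarith
  set v := ENNReal.ofReal (1 - 10 * (k + 1) / N : ℝ) * ENNReal.ofReal (1 - (k + 1) / N : ℝ)
  set TA := t.eval (3 * N) with hTA
  have e3 : N + N + N = 3 * N := by ring
  have e4 : N + N + N + N = 4 * N := by ring
  set Trec := (k + 1) * (t.eval (4 * N) + (90 * (N + TA) + 2 * B + 50)) + 30 * k + 40 with hTrec
  set Z := List.replicate p false with hZ
  set ls : List (List Bool) := [[], unary (k + 1), unary N, Z, [], [], [], [], []] with hls
  have hpost : ∀ m : Mem, (∃ Q : PMF (Fin (p + (k + 1)) → Bool),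
      tv (paddedParity p s noiseRate) Q < 1 / N ∧
        IsEvaluator E (m.reg 0) (fun m => t.eval (N + N + N + m)) Q) ∧
        (m.reg 0).length ≤ N + TA → M.Leaves m.qmem →
      v ≤ hit O f (12 * (N + TA) + 3 + Trec + 1)
        ([.seq (prepend 0 (B + 4) (B + 0)) (recoverProg B M E)], m.embed B ls) := by
    rintro m ⟨⟨Q, hQ, hw⟩, hlen⟩ hq
    have h1 : Exec (prepend 0 (B + 4) (B + 0)) (memOf B m.reg m.qmem ls)
        (12 * (m.reg 0).length + 3) (memOf B m.reg m.qmem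
          [[], unary (k + 1), unary N, Z, m.reg 0 ++ [], [], [], [], []]) :=
      exec_prepend_low_high (j := 4) (by omega) (by omega) (by simp [hls]) rfl
    rw [List.append_nil] at h1
    have h2 := le_hit_recoverProg (O := O) (f := f) (a := m.reg) hpN hE hEB hB hp hQ hw
      (ℓ := N + TA) (by omega) hlen (fun m' hm' => by simp [hf, hm']) hq
    rw [e4] at h2
    exact h2.trans ((h1.hit_le_seq _ _ _).trans (hit_mono_time (by omega) _))
  have hsim := runFor_mul_le_hit (B := B) (ls := ls) (O := O)
    (O' := samp (paddedParity p s noiseRate)) (pad := paddedSample B) (cost := 12 * p + 6)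
    (by omega)
    (by
      intro r hr m f K
      rw [samp_paddedParity]
      exact ev_le_hit_paddedSample rfl rfl r hr m f K)
    (I := M.Leaves) (a := v) (f := hit O f (12 * (N + TA) + 3 + Trec + 1)) hpost TA [A]
    (initMem [unary N, unary N, unary N])
    (by
      intro p hp
      rw [List.mem_singleton] at hp
      subst hp
      exact ⟨hAB, hA.isClassical_or⟩)
    M.leaves_zero
  have hlen := successProb_le_of_length (O := samp (paddedParity p s noiseRate)) (ℓ := N)
    (fun l hl => by rw [length_of_mem_support_samp hl, hpN]) TA (A := A)
    (inputs := [unary N, unary N, unary N]) (by simp [length_unary])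
    (fun w => ∃ Q : PMF (Fin (p + (k + 1)) → Bool), tv (paddedParity p s noiseRate) Q < 1 / N ∧
      IsEvaluator E w (fun m => t.eval (N + N + N + m)) Q)
  rw [e3] at hlearn
  rw [e3] at hlen hsim
  have hsetup := exec_setupProg (B := B) (a := (initMem [unary k, unary D]).reg)
    (q := QState.zero) hB (k := k) (D := D) rfl rfl (by omega) hN hkN
  have hp' : N - (k + 1) = p := by omega
  rw [hp', ← hZ, ← hls] at hsetup
  have hinit : initMem [unary k, unary D] =
      memOf B (initMem [unary k, unary D]).reg QState.zero (List.replicate 9 []) := by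
    refine Mem.ext' (fun r => ?_) rfl
    by_cases hr : r < B
    · rw [memOf_reg_low hr]
    · have h2 : 2 ≤ r := by omega
      simp only [memOf, hr, if_false, initMem]
      rw [List.getD_eq_default _ _ (by simpa using h2), List.getD_eq_getElem?_getD,
        List.getElem?_replicate]
      split_ifs <;> rfl
  rw [hinit]
  refine hnum.trans ((mul_le_mul_left (hlearn.trans hlen) v).trans (hsim.trans ?_))
  refine (hit_hit_le _ _ _).trans ((hit_seq _ _ _ _ _).trans ?_)
  refine (hsetup.hit_le_seq _ _ _).trans (hit_mono_time ?_ _)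
  rw [lpnTime_eval, ← hTA, hTrec]
  have m1 : (12 * p + 6) * TA ≤ (12 * N + 6) * TA := Nat.mul_le_mul_right _ (by omega)
  have m2 : (k + 1) * (t.eval (4 * N) + (90 * (N + TA) + 2 * B + 50)) ≤
      (N + 1) * (t.eval (4 * N) + (90 * (N + TA) + (2 * B + 50))) :=
    Nat.mul_le_mul (by omega) (by omega)
  omega

/-- As d(n) ≥ n^e eventually, padding to a polynomially larger number N of wires buys enough depth,
and polynomial time in N is still polynomial in k and 1/δ. -/
theorem lpnEasy_of_efficientlyLearnable {M : Model} {d : ℕ → ℕ}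
    (hd : ∃ c : ℝ, 0 < c ∧ ∀ᶠ n : ℕ in Filter.atTop, (n : ℝ) ^ c ≤ (d n : ℝ))
    (h : EfficientlyLearnable M fun n => cliffordOneT n (d n)) : LPNEasy M noiseRate := by
  obtain ⟨e, he, hev⟩ := hd
  obtain ⟨n₀, hn₀⟩ := Filter.eventually_atTop.1 hev
  obtain ⟨A, E, hA, hE, -, t, hlearn⟩ := h
  set B := max 3 (max A.bound E.bound) with hB
  -- With b = k + D + c and N = b^j, this gives N ≥ b ≥ n₀, so that the bound on `d` applies, and b
  -- ≥ 12. The exponent `j` ensures N^e ≥ b² ≥ 12b ≥ 3k + 3 as well as N ≥ b³ ≥ 12(k + 1)D.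
  set c := n₀ + 12 with hc
  set j := ⌈2 / e⌉₊ + 3 with hj
  refine ⟨lpnProg M A E B c j, allows_lpnProg hA hE B c j,
    (lpnTime B j t).comp ((Polynomial.X + Polynomial.C c) ^ j), fun k s δ hδ hδ' => ?_⟩
  set D := ⌈1 / δ⌉₊ with hD
  have hDδ : 1 / δ ≤ D := Nat.le_ceil _
  have hD1 : 1 ≤ D := by
    rw [hD, Nat.one_le_ceil_iff]
    positivity
  have hDpos : (0 : ℝ) < D := by exact_mod_cast hD1
  set b := k + D + c with hb
  obtain ⟨N, hN⟩ : ∃ N, b ^ j = N := ⟨_, rfl⟩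
  have hb1 : 1 ≤ b := by omega
  have hb3 : b ^ 3 ≤ N := hN ▸ Nat.pow_le_pow_right hb1 (by omega)
  have hbN : b ≤ N := (Nat.le_self_pow (by norm_num) b).trans hb3
  have h12 : 12 * (k + 1) * D ≤ N := by
    refine le_trans ?_ hb3
    have : b ^ 3 = b * b * b := by ring
    rw [this]
    exact Nat.mul_le_mul (Nat.mul_le_mul (by omega) (by omega)) (by omega)
  have hdN : 3 * k + 3 ≤ d N := by
    have h1 := hn₀ N (by omega)
    have h2 : (b : ℝ) ^ (2 : ℝ) ≤ (N : ℝ) ^ e := by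
      rw [← hN, Nat.cast_pow, ← Real.rpow_natCast, ← Real.rpow_mul (by positivity)]
      refine Real.rpow_le_rpow_of_exponent_le (by exact_mod_cast hb1) ?_
      have h3 : 2 / e ≤ j := (Nat.le_ceil _).trans (by rw [hj]; push_cast; linarith)
      rwa [div_le_iff₀ he] at h3
    have h4 : b ^ 2 ≤ d N := by
      have := h2.trans h1
      rw [Real.rpow_ofNat] at this
      exact_mod_cast this
    have h5 : 12 * b ≤ b ^ 2 := by rw [sq]; exact Nat.mul_le_mul_right _ (by omega)
    omega
  obtain ⟨p, hp⟩ : ∃ p, N = p + (k + 1) := ⟨N - (k + 1), by omega⟩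
  have hNpos : (0 : ℝ) < N := by
    have : 0 < N := by omega
    exact_mod_cast this
  have hN1 : (1 / N : ℝ) < 1 := by
    rw [div_lt_one hNpos]
    have : 1 < N := by omega
    exact_mod_cast this
  have hlearnN : ENNReal.ofReal (1 - 1 / N) ≤
      successProb (samp (paddedParity p s noiseRate)) A [unary N, unary N, unary N]
        (t.eval (N + N + N)) (fun w => ∃ Q : PMF (Fin (p + (k + 1)) → Bool),
          tv (paddedParity p s noiseRate) Q < 1 / N ∧
            IsEvaluator E w (fun m => t.eval (N + N + N + m)) Q) := by
    -- Taking ε = δ = 1/N makes all three inputs of the learner equal to N in unary.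
    have h1 := hlearn (p + (k + 1)) (paddedParity p s noiseRate)
      (paddedParity_mem_cliffordOneT p s (by rw [← hp]; exact hdN)) (1 / N) (1 / N) (by positivity)
      hN1 (by positivity) hN1
    simp only [one_div_one_div, Nat.ceil_natCast, ← hp] at h1
    exact h1
  have hmain := le_successProb_lpnProg (t := t) (B := B) hA hE (by omega) (by omega) (by omega) s hN hp
    (by omega) hbN h12 hD1 hlearnN
  have heval : ((lpnTime B j t).comp ((Polynomial.X + Polynomial.C c) ^ j)).eval (k + D) =
      (lpnTime B j t).eval N := by
    rw [← hN]
    simp [Polynomial.eval_comp, hb]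
  rw [heval]
  refine le_trans (ENNReal.ofReal_le_ofReal ?_) hmain
  have : 1 / (D : ℝ) ≤ δ := by
    rw [div_le_iff₀ hDpos]
    rwa [div_le_iff₀ hδ, mul_comm] at hDδ
  linarith

end QLearn
end

theorem theorem2 (M : QLearn.Model) (hLPN : QLearn.LPNAssumption M)
    (d : ℕ → ℕ) (hd : ∃ c : ℝ, 0 < c ∧ ∀ᶠ n : ℕ in Filter.atTop, (n : ℝ) ^ c ≤ (d n : ℝ)) :
    ¬ QLearn.EfficientlyLearnable M (fun n => QLearn.cliffordOneT n (d n)) := by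
  intro h
  refine hLPN QLearn.noiseRate QLearn.noiseRate_pos ?_ (QLearn.lpnEasy_of_efficientlyLearnable hd h)
  linarith [QLearn.noiseRate_le]
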